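/- **Lemma 4.2 (asymptotic equicontinuity of value functions).** Let $n\ge 1$, $2<p<\infty$, $T>0$, and let $\Omega\subset\mathbb R^n$ be a bounded domain satisfying the uniform exterior sphere condition: there is $\delta>0$ such that for every $y\in\partial\Omega$ there is an open ball $B_\delta\subset\mathbb R^n\setminus\Omega$ of radius $\delta$ with $\overline B_\delta\cap\overline\Omega=\{y\}$. Put $\Omega_T=\Omega\times(0,T)$ and, for $\varepsilon>0$, $$S_\varepsilon=\{x\in\mathbb R^n\setminus\Omega:\operatorname{dist}(x,\partial\Omega)\le\varepsilon\},\qquad \Gamma_\varepsilon=\big(S_\varepsilon\times[-\varepsilon^2,T]\big)\cup\big(\Omega\times[-\varepsilon^2,0]\big).$$ Let $F:\Gamma_1\to\mathbb R$ be continuous, $\alpha=\frac{p-2}{p+n}$ and $\beta=\frac{n+2}{p+n}$. For $\varepsilon\in(0,1)$ consider the following control problem. A token starts at $(x_0,t_0)\in\overline\Omega_T=\overline{\Omega}\times[0,T]$. A strategy $S$ is a Borel measurable rule assigning to each history a unit vector $\sigma=S(t_0,x_0,\dots,x_k)\in\mathbb R^n$. Given the history, $t_{k+1}=t_k-\varepsilon^2$,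 and $x_{k+1}$ is, with probability $\beta$, uniformly distributed in the ball $B_\varepsilon(x_k)$, and equals $x_k+\varepsilon\sigma$ and $x_k-\varepsilon\sigma$ with probability $\alpha/2$ each. Let $\tau$ be the first $k\ge 0$ with $(x_k,t_k)\in\Gamma_\varepsilon$ (so $\tau=0$ if the token starts in $\Gamma_\varepsilon$), and let $$u_\varepsilon(x_0,t_0)=\sup_S\mathbb E_S^{(x_0,t_0)}\big[F(x_\tau,t_\tau)\big]$$ be the value of the game. Then: 1. $|u_\varepsilon(x,t)|\le\max_{\Gamma_1}|F|$ for all $(x,t)\in\overline\Omega_T$ and all $\varepsilon\in(0,1)$. 2. For every $\eta>0$ there are $r_0>0$ and $\varepsilon_0>0$ such that for every $\varepsilon\in(0,1)$ with $\varepsilon<\varepsilon_0$ and all $(x,t),(y,s)\in\overline\Omega_T$ with $|(x,t)-(y,s)|<r_0$, $$|u_\varepsilon(x,t)-u_\varepsilon(y,s)|<\eta.$$ -/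

import Mathlib

open MeasureTheory ProbabilityTheory
open scoped ENNReal

namespace DominativeGame

noncomputable section

/-- Euclidean space `ℝⁿ`. -/
abbrev Space (n : ℕ) : Type := EuclideanSpace ℝ (Fin n)

/-- Bounded domains satisfying the uniform exterior sphere condition. -/
structure IsGameDomain {n : ℕ} (Ω : Set (Space n)) : Prop where
  isOpen : IsOpen Ω
  isConnected : IsConnected Ω
  isBounded : Bornology.IsBounded Ω
  exteriorSphere : ∃ δ : ℝ, 0 < δ ∧ ∀ y ∈ frontier Ω, ∃ z : Space n,
    Metric.ball z δ ⊆ Ωᶜ ∧ Metric.closedBall z δ ∩ closure Ω = {y}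

/-- The open space-time cylinder `Ω × (0, T)`. -/
def cylinder {n : ℕ} (Ω : Set (Space n)) (T : ℝ) : Set (Space n × ℝ) :=
  Ω ×ˢ Set.Ioo 0 T

/-- The outer strip `{x ∉ Ω : dist (x, ∂Ω) ≤ ε}`. -/
def outerStrip {n : ℕ} (Ω : Set (Space n)) (ε : ℝ) : Set (Space n) :=
  {x | x ∉ Ω ∧ Metric.infDist x (frontier Ω) ≤ ε}

/-- The parabolic boundary strip of width `ε`: the lateral part runs over all times in
`[-ε², T]`, the bottom part over times in `[-ε², 0]`. -/
def boundaryStrip {n : ℕ} (Ω : Set (Space n)) (T ε : ℝ) : Set (Space n × ℝ) :=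
  (outerStrip Ω ε ×ˢ Set.Icc (-ε ^ 2) T) ∪ (Ω ×ˢ Set.Icc (-ε ^ 2) 0)

/-- The Euclidean distance of `ℝⁿ⁺¹` between two space-time points. -/
def spaceTimeDist {n : ℕ} (P Q : Space n × ℝ) : ℝ :=
  Real.sqrt (‖P.1 - Q.1‖ ^ 2 + (P.2 - Q.2) ^ 2)

/-- A strategy of the controller: Borel functions giving a unit vector for each starting time
`t₀` and each history `x₀, …, x_k` of positions. -/
structure Strategy (n : ℕ) where
  dir : (k : ℕ) → ℝ → (Finset.Iic k → Space n) → Space n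
  measurable_dir : ∀ k, Measurable (Function.uncurry (dir k))
  norm_dir : ∀ k t₀ h, ‖dir k t₀ h‖ = 1

/-- Probability that the controller chooses the direction of the move. -/
def coinAlpha (n : ℕ) (p : ℝ) : ℝ := (p - 2) / (p + n)

/-- Probability of a uniformly random move. -/
def coinBeta (n : ℕ) (p : ℝ) : ℝ := (n + 2) / (p + n)

/-- Law of the next position, from the position `x` with chosen direction `σ`: with probability
`β` uniform in the ball `B_ε(x)`, and with probability `α / 2` each of the points `x ± ε σ`. -/
def stepMeasure {n : ℕ} (p ε : ℝ) (x σ : Space n) : Measure (Space n) :=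
  ENNReal.ofReal (coinBeta n p) • (volume : Measure (Space n))[|Metric.ball x ε]
    + ENNReal.ofReal (coinAlpha n p / 2) • Measure.dirac (x + ε • σ)
    + ENNReal.ofReal (coinAlpha n p / 2) • Measure.dirac (x - ε • σ)

lemma measurable_stepMeasure {n : ℕ} (p ε : ℝ) :
    Measurable (fun q : Space n × Space n => stepMeasure p ε q.1 q.2) := by
  refine Measure.measurable_of_measurable_coe _ fun A hA => ?_
  have hball : Measurable fun x : Space n => volume (Metric.ball x ε ∩ A) := by
    have hs1 : MeasurableSet {q : Space n × Space n | dist q.2 q.1 < ε} :=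
      (isOpen_lt (continuous_snd.dist continuous_fst) continuous_const).measurableSet
    have hs2 : MeasurableSet {q : Space n × Space n | q.2 ∈ A} := measurable_snd hA
    exact measurable_measure_prodMk_left (hs1.inter hs2)
  have h1 : Measurable fun q : Space n × Space n =>
      ((volume : Measure (Space n))[|Metric.ball q.1 ε]) A := by
    have : ∀ q : Space n × Space n, ((volume : Measure (Space n))[|Metric.ball q.1 ε]) A
        = (volume (Metric.ball (0 : Space n) ε))⁻¹ * volume (Metric.ball q.1 ε ∩ A) := by
      intro q
      rw [cond_apply measurableSet_ball, Measure.addHaar_ball_center]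
    simp only [this]
    exact (hball.comp measurable_fst).const_mul _
  have hd : Measurable fun x : Space n => Measure.dirac x A :=
    (Measure.measurable_coe hA).comp Measure.measurable_dirac
  have c2 : Measurable fun q : Space n × Space n => q.1 + ε • q.2 :=
    (continuous_fst.add (continuous_snd.const_smul ε)).measurable
  have c3 : Measurable fun q : Space n × Space n => q.1 - ε • q.2 :=
    (continuous_fst.sub (continuous_snd.const_smul ε)).measurable
  have h2 : Measurable fun q : Space n × Space n => Measure.dirac (q.1 + ε • q.2) A :=
    hd.comp c2
  have h3 : Measurable fun q : Space n × Space n => Measure.dirac (q.1 - ε • q.2) A :=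
    hd.comp c3
  simp only [stepMeasure, Measure.add_apply, Measure.smul_apply, smul_eq_mul]
  exact ((h1.const_mul _).add (h2.const_mul _)).add (h3.const_mul _)

lemma isProbabilityMeasure_stepMeasure {n : ℕ} {p ε : ℝ} (hp : 2 < p) (hε : 0 < ε)
    (x σ : Space n) : IsProbabilityMeasure (stepMeasure p ε x σ) := by
  have hb0 : volume (Metric.ball x ε) ≠ 0 := (Metric.measure_ball_pos volume x hε).ne'
  have : IsProbabilityMeasure ((volume : Measure (Space n))[|Metric.ball x ε]) :=
    cond_isProbabilityMeasure_of_finite hb0 measure_ball_lt_top.ne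
  have hpn : 0 < p + n := by positivity
  have hα : 0 ≤ coinAlpha n p / 2 :=
    div_nonneg (div_nonneg (by linarith) hpn.le) (by norm_num)
  have hβ : 0 ≤ coinBeta n p := div_nonneg (by positivity) hpn.le
  refine ⟨?_⟩
  simp only [stepMeasure, Measure.add_apply, Measure.smul_apply, smul_eq_mul, measure_univ,
    mul_one]
  rw [← ENNReal.ofReal_add hβ hα, ← ENNReal.ofReal_add (add_nonneg hβ hα) hα,
    ENNReal.ofReal_eq_one]
  simp only [coinAlpha, coinBeta]
  field_simp
  ring

lemma measurable_stepLaw {n : ℕ} (p ε : ℝ) (S : Strategy n) (t₀ : ℝ) (k : ℕ) :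
    Measurable (fun h : Finset.Iic k → Space n =>
      stepMeasure p ε (h ⟨k, Finset.mem_Iic.2 le_rfl⟩) (S.dir k t₀ h)) := by
  have h1 : Measurable fun h : Finset.Iic k → Space n => h ⟨k, Finset.mem_Iic.2 le_rfl⟩ :=
    measurable_pi_apply _
  have h0 : Measurable fun h : Finset.Iic k → Space n => (t₀, h) := measurable_prodMk_left
  have h2 : Measurable fun h : Finset.Iic k → Space n => S.dir k t₀ h :=
    (S.measurable_dir k).comp h0
  have h3 := (measurable_stepMeasure (n := n) p ε).comp (h1.prodMk h2)
  simpa only [Function.comp_def] using h3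

/-- The transition kernel of the game with starting time `t₀` and strategy `S`, from the history
of positions `x₀, …, x_k` to the position `x_{k+1}`. The time component of the token is
deterministic, `t_k = t₀ - k ε²`, and is not part of the random state. -/
def stepKernel {n : ℕ} {p ε : ℝ} (_hp : 2 < p) (_hε : 0 < ε) (S : Strategy n) (t₀ : ℝ) (k : ℕ) :
    Kernel (Finset.Iic k → Space n) (Space n) where
  toFun h := stepMeasure p ε (h ⟨k, Finset.mem_Iic.2 le_rfl⟩) (S.dir k t₀ h)
  measurable' := measurable_stepLaw p ε S t₀ k

instance {n : ℕ} {p ε : ℝ} (hp : 2 < p) (hε : 0 < ε) (S : Strategy n) (t₀ : ℝ) (k : ℕ) :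
    IsMarkovKernel (stepKernel hp hε S t₀ k) :=
  ⟨fun _ => isProbabilityMeasure_stepMeasure hp hε _ _⟩

/-- The law of the sequence of token positions for the starting point `(x₀, t₀) = P` and the
strategy `S`, given by the Ionescu-Tulcea theorem. -/
def gameMeasure {n : ℕ} {p ε : ℝ} (hp : 2 < p) (hε : 0 < ε) (S : Strategy n)
    (P : Space n × ℝ) : Measure (ℕ → Space n) :=
  Kernel.traj (X := fun _ => Space n) (stepKernel hp hε S P.2) 0 (fun _ => P.1)

/-- The token `(x_k, t_k)` after `k` rounds of a game started at time `t₀`. -/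
def token {n : ℕ} (ε t₀ : ℝ) (ω : ℕ → Space n) (k : ℕ) : Space n × ℝ :=
  (ω k, t₀ - k * ε ^ 2)

/-- The first round at which the token lies in the boundary strip. A token started in
`closure (Ω × (0, T))` almost surely reaches the strip, after at most `t₀ / ε² + 1` rounds. -/
def stoppingRound {n : ℕ} (Ω : Set (Space n)) (T ε t₀ : ℝ) (ω : ℕ → Space n) : ℕ :=
  sInf {k | token ε t₀ ω k ∈ boundaryStrip Ω T ε}

/-- The expected payoff of the controller under the strategy `S`, from the starting point `P`. -/
def expectedPayoff {n : ℕ} {p ε : ℝ} (hp : 2 < p) (hε : 0 < ε) (Ω : Set (Space n)) (T : ℝ)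
    (F : Space n × ℝ → ℝ) (S : Strategy n) (P : Space n × ℝ) : ℝ :=
  ∫ ω, F (token ε P.2 ω (stoppingRound Ω T ε P.2 ω)) ∂(gameMeasure hp hε S P)

/-- The value of the game with starting point `P`. -/
def value {n : ℕ} {p ε : ℝ} (hp : 2 < p) (hε : 0 < ε) (Ω : Set (Space n)) (T : ℝ)
    (F : Space n × ℝ → ℝ) (P : Space n × ℝ) : ℝ :=
  ⨆ S : Strategy n, expectedPayoff hp hε Ω T F S P

end

end DominativeGame

/-! The two games are coupled by translation. A strategy for the start `P` is carried to the start
`Q = P + (ξ, s)` by `Strategy.translate`; the game from `Q` then follows `ω + ξ`, where `ω` is the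
path of the game from `P` (`gameMeasure_translate`). Both payoffs become integrals over one path
law, and the stopped tokens differ only by the small shift and because the games stop in different
rounds `τ`, `τ'`.

The gap between `τ` and `τ'` is controlled by a barrier (`exists_isBarrier`): `exp (-lam * d ^ 2)`,
with `d` the distance to the centres of exterior balls of radius `δ`. Over `closure Ω` it is largest
on the boundary, and from points of `Ω` it gains at least `c * ε ^ 2` in mean per step, whatever the
direction, since the uniform part of the step spreads in all directions. When one path has left `Ω`,
the barrier at the other is at least its boundary value minus `L * (ε + ‖ξ‖)`, and up to the exit it
cannot exceed that value by more than `L * ε`. So the mean remaining time is `O(ε + ‖ξ‖)`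
(`integral_exitRound_sub_min_le`); the different time horizons add `|s| + ε ^ 2`.

The path is a martingale with steps at most `ε`, hence the mean of `‖ω τ - ω τ'‖ ^ 2` is at most `ε
^ 2` times the mean of `|τ - τ'|` (`integral_norm_sub_exitRound_sq_le`). The modulus of `F` from
`exists_parabolic_modulus` is affine in squared distance and elapsed time, so it can be integrated
directly. The supremum over strategies and the exchange of `P` and `Q` give equicontinuity. The
uniform bound holds because the stopped token almost surely lies in the strip. -/

namespace DominativeGame

/-! ### One step of the game: symmetry and moment estimates -/

section StepMeasure

variable {n : ℕ} {p ε : ℝ} {x σ : Space n}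

lemma map_cond_of_measurePreserving {X : Type*} [MeasurableSpace X] {μ : Measure X} {g : X → X}
    (hg : MeasurePreserving g μ μ) {A : Set X} (hA : MeasurableSet A) :
    (μ[|g ⁻¹' A]).map g = μ[|A] := by
  ext B hB
  rw [Measure.map_apply hg.measurable hB, cond_apply (hg.measurable hA), cond_apply hA,
    ← Set.preimage_inter, hg.measure_preimage hA.nullMeasurableSet,
    hg.measure_preimage (hA.inter hB).nullMeasurableSet]

lemma map_stepMeasure_of_measurePreserving {g : Space n → Space n}
    (hg : MeasurePreserving g (volume : Measure (Space n)) volume) {x' : Space n}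
    (hball : g ⁻¹' Metric.ball x' ε = Metric.ball x ε) :
    (stepMeasure p ε x σ).map g =
      ENNReal.ofReal (coinBeta n p) • (volume : Measure (Space n))[|Metric.ball x' ε]
        + ENNReal.ofReal (coinAlpha n p / 2) • Measure.dirac (g (x + ε • σ))
        + ENNReal.ofReal (coinAlpha n p / 2) • Measure.dirac (g (x - ε • σ)) := by
  rw [stepMeasure, Measure.map_add _ _ hg.measurable, Measure.map_add _ _ hg.measurable,
    Measure.map_smul, Measure.map_smul, Measure.map_smul, Measure.map_dirac' hg.measurable,
    Measure.map_dirac' hg.measurable, ← hball,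
    map_cond_of_measurePreserving hg Metric.isOpen_ball.measurableSet]

lemma map_add_right_stepMeasure (ξ : Space n) :
    (stepMeasure p ε x σ).map (· + ξ) = stepMeasure p ε (x + ξ) σ := by
  rw [map_stepMeasure_of_measurePreserving (x' := x + ξ) (measurePreserving_add_right volume ξ)
    (by ext y; simp [dist_eq_norm])]
  simp only [stepMeasure, add_right_comm, sub_add_eq_add_sub]

/-- The reflection in `x` preserves the ball and swaps the two atoms. Averaging a function with its
mirror image then cancels all terms odd in `y - x`, so no first-order term survives in the mean
estimates. -/
lemma map_reflect_stepMeasure :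
    (stepMeasure p ε x σ).map (fun y => x + x - y) = stepMeasure p ε x σ := by
  rw [map_stepMeasure_of_measurePreserving (x' := x)
    (Measure.measurePreserving_sub_left volume (x + x))
    (by
      ext y
      simp only [Set.mem_preimage, Metric.mem_ball, dist_eq_norm]
      rw [show x + x - y - x = -(y - x) by abel, norm_neg])]
  have h1 : x + x - (x + ε • σ) = x - ε • σ := by abel
  have h2 : x + x - (x - ε • σ) = x + ε • σ := by abel
  rw [h1, h2, stepMeasure, add_right_comm]

lemma integral_reflect_stepMeasure (f : Space n → ℝ) :
    ∫ y, f (x + x - y) ∂(stepMeasure p ε x σ) = ∫ y, f y ∂(stepMeasure p ε x σ) := by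
  conv_rhs => rw [← map_reflect_stepMeasure]
  exact ((MeasurableEquiv.subLeft (x + x)).measurableEmbedding.integral_map f).symm

lemma integral_add_right_stepMeasure (ξ : Space n) (f : Space n → ℝ) :
    ∫ y, f (y + ξ) ∂(stepMeasure p ε x σ) = ∫ y, f y ∂(stepMeasure p ε (x + ξ) σ) := by
  rw [← map_add_right_stepMeasure]
  exact ((MeasurableEquiv.addRight ξ).measurableEmbedding.integral_map f).symm

lemma lintegral_add_right_stepMeasure (ξ : Space n) {f : Space n → ℝ≥0∞} (hf : Measurable f) :
    ∫⁻ y, f (y + ξ) ∂(stepMeasure p ε x σ) = ∫⁻ y, f y ∂(stepMeasure p ε (x + ξ) σ) := by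
  rw [← map_add_right_stepMeasure, lintegral_map hf (measurable_add_const ξ)]

lemma ae_norm_sub_le_stepMeasure (hε : 0 < ε) (hσ : ‖σ‖ = 1) :
    ∀ᵐ y ∂(stepMeasure p ε x σ), ‖y - x‖ ≤ ε := by
  have hs : MeasurableSet {y : Space n | ‖y - x‖ ≤ ε} :=
    (isClosed_le (by fun_prop) continuous_const).measurableSet
  have hb : ∀ᵐ y ∂((volume : Measure (Space n))[|Metric.ball x ε]), ‖y - x‖ ≤ ε := by
    refine (ae_cond_mem Metric.isOpen_ball.measurableSet).mono fun y hy => ?_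
    rw [← dist_eq_norm]
    exact (Metric.mem_ball.1 hy).le
  have hn : ‖ε • σ‖ = ε := by rw [norm_smul, hσ, mul_one, Real.norm_of_nonneg hε.le]
  rw [stepMeasure, ae_add_measure_iff, ae_add_measure_iff]
  refine ⟨⟨Measure.ae_smul_measure hb _, Measure.ae_smul_measure ?_ _⟩,
    Measure.ae_smul_measure ?_ _⟩
  · rw [ae_dirac_iff hs]; simp [hn]
  · rw [ae_dirac_iff hs]; simp [hn]

lemma coinBeta_pos (n : ℕ) (hp : 2 < p) : 0 < coinBeta n p := by
  have : (0 : ℝ) < p + n := by positivity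
  exact div_pos (by positivity) this

/-- Only the uniform part of the step is used, which makes the bound independent of the chosen
direction. -/
lemma mul_measureReal_ball_le_stepMeasure (hp : 2 < p) (hε : 0 < ε) {z : Space n}
    (hz : ‖z - x‖ ≤ ε / 2) :
    coinBeta n p / 4 ^ n ≤ (stepMeasure p ε x σ).real (Metric.ball z (ε / 4)) := by
  have := isProbabilityMeasure_stepMeasure hp hε x σ
  have hsub : Metric.ball z (ε / 4) ⊆ Metric.ball x ε := by
    refine Metric.ball_subset_ball' ?_
    rw [dist_eq_norm]; linarith
  have hne : volume (Metric.ball x ε) ≠ 0 := (Metric.measure_ball_pos volume x hε).ne'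
  have hvol : (volume : Measure (Space n)) (Metric.ball z (ε / 4))
      = ENNReal.ofReal ((1 / 4) ^ n) * volume (Metric.ball x ε) := by
    rw [show ε / 4 = (1 / 4) * ε by ring, Measure.addHaar_ball_mul_of_pos _ _ (by norm_num),
      Measure.addHaar_ball_center _ x]
    simp
  have hcond : ((volume : Measure (Space n))[|Metric.ball x ε]) (Metric.ball z (ε / 4))
      = ENNReal.ofReal ((1 / 4) ^ n) := by
    rw [cond_apply Metric.isOpen_ball.measurableSet, Set.inter_eq_right.2 hsub, hvol,
      mul_left_comm, ENNReal.inv_mul_cancel hne measure_ball_lt_top.ne, mul_one]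
  have hle : ENNReal.ofReal (coinBeta n p / 4 ^ n)
      ≤ stepMeasure p ε x σ (Metric.ball z (ε / 4)) := by
    calc ENNReal.ofReal (coinBeta n p / 4 ^ n)
        = ENNReal.ofReal (coinBeta n p)
            * ((volume : Measure (Space n))[|Metric.ball x ε]) (Metric.ball z (ε / 4)) := by
          rw [hcond, ← ENNReal.ofReal_mul (coinBeta_pos n hp).le]
          congr 1
          rw [div_pow, one_pow]; ring
      _ ≤ _ := by
          rw [stepMeasure, add_assoc, Measure.add_apply, Measure.smul_apply, smul_eq_mul]
          exact le_self_add
  exact (ENNReal.ofReal_le_iff_le_toReal (measure_ne_top _ _)).1 hle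

lemma integrable_stepMeasure_of_continuous (hp : 2 < p) (hε : 0 < ε) (hσ : ‖σ‖ = 1)
    {f : Space n → ℝ} (hf : Continuous f) : Integrable f (stepMeasure p ε x σ) := by
  have := isProbabilityMeasure_stepMeasure hp hε x σ
  obtain ⟨C, hC⟩ := (isCompact_closedBall x ε).exists_bound_of_continuousOn hf.continuousOn
  refine Integrable.of_bound hf.aestronglyMeasurable C ?_
  filter_upwards [ae_norm_sub_le_stepMeasure hε hσ] with y hy
  exact hC y (by rwa [Metric.mem_closedBall, dist_eq_norm])

/-- Nondegeneracy of the noise in every direction. On the ball of radius `ε / 4` about `x + (ε / 2)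
v / ‖v‖` the inner product is at least `ε * ‖v‖ / 4`; Markov's inequality concludes. -/
lemma le_integral_inner_sq_stepMeasure (hp : 2 < p) (hε : 0 < ε) (hσ : ‖σ‖ = 1) (v : Space n) :
    coinBeta n p / 4 ^ n / 16 * ε ^ 2 * ‖v‖ ^ 2
      ≤ ∫ y, (inner ℝ v (y - x)) ^ 2 ∂(stepMeasure p ε x σ) := by
  have := isProbabilityMeasure_stepMeasure hp hε x σ
  by_cases hv : v = 0
  · simp [hv]
  have hv0 : 0 < ‖v‖ := norm_pos_iff.2 hv
  set z : Space n := x + (ε / 2 / ‖v‖) • v with hz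
  have hzx : ‖z - x‖ ≤ ε / 2 := by
    rw [hz, add_sub_cancel_left, norm_smul, Real.norm_of_nonneg (by positivity)]
    exact (div_mul_cancel₀ _ hv0.ne').le
  have hsub : Metric.ball z (ε / 4) ⊆ {y | ε ^ 2 * ‖v‖ ^ 2 / 16 ≤ (inner ℝ v (y - x)) ^ 2} := by
    intro y hy
    rw [Metric.mem_ball, dist_eq_norm] at hy
    have h1 : inner ℝ v (y - x) = ε / 2 * ‖v‖ + inner ℝ v (y - z) := by
      rw [show y - x = (ε / 2 / ‖v‖) • v + (y - z) by rw [hz]; abel, inner_add_right,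
        real_inner_smul_right, real_inner_self_eq_norm_sq]
      field_simp
    have h2 : |inner ℝ v (y - z)| ≤ ‖v‖ * (ε / 4) :=
      (abs_real_inner_le_norm _ _).trans (by gcongr)
    have h3 := (abs_le.1 h2).1
    have h4 : ε * ‖v‖ / 4 ≤ inner ℝ v (y - x) := by rw [h1]; linarith
    have h5 : 0 ≤ ε * ‖v‖ / 4 := by positivity
    calc ε ^ 2 * ‖v‖ ^ 2 / 16 = (ε * ‖v‖ / 4) ^ 2 := by ring
      _ ≤ _ := pow_le_pow_left₀ h5 h4 2
  have hM := mul_meas_ge_le_integral_of_nonneg (μ := stepMeasure p ε x σ)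
    (f := fun y => (inner ℝ v (y - x)) ^ 2) (ae_of_all _ fun y => sq_nonneg _)
    (integrable_stepMeasure_of_continuous hp hε hσ (by fun_prop)) (ε ^ 2 * ‖v‖ ^ 2 / 16)
  refine le_trans ?_ hM
  calc coinBeta n p / 4 ^ n / 16 * ε ^ 2 * ‖v‖ ^ 2
      = ε ^ 2 * ‖v‖ ^ 2 / 16 * (coinBeta n p / 4 ^ n) := by ring
    _ ≤ ε ^ 2 * ‖v‖ ^ 2 / 16 * (stepMeasure p ε x σ).real (Metric.ball z (ε / 4)) := by
        gcongr
        exact mul_measureReal_ball_le_stepMeasure hp hε hzx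
    _ ≤ _ := mul_le_mul_of_nonneg_left (measureReal_mono hsub (measure_ne_top _ _))
        (by positivity)

lemma one_add_sq_half_le_cosh (s : ℝ) : 1 + s ^ 2 / 2 ≤ Real.cosh s := by
  have h1 : Real.cosh s = 1 + 2 * Real.sinh (s / 2) ^ 2 := by
    have := Real.cosh_two_mul (s / 2)
    rw [mul_div_cancel₀ s two_ne_zero, Real.cosh_sq] at this
    linarith
  have h2 : (s / 2) ^ 2 ≤ Real.sinh (s / 2) ^ 2 := by
    rw [sq_le_sq, Real.abs_sinh]
    exact Real.self_le_sinh_iff.2 (abs_nonneg _)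
  rw [h1]; linarith

/-- A Gaussian centred at `z` grows in mean along a step, up to the factor `1 - lam * ε ^ 2`, by
an amount controlled by the distance to its centre. -/
lemma le_integral_gaussian_stepMeasure (hp : 2 < p) (hε : 0 < ε) (hσ : ‖σ‖ = 1) {lam : ℝ}
    (hlam : 0 ≤ lam) (hlε : lam * ε ^ 2 ≤ 1) (z : Space n) :
    Real.exp (-lam * ‖x - z‖ ^ 2) * ((1 - lam * ε ^ 2)
        * (1 + 2 * lam ^ 2 * (coinBeta n p / 4 ^ n / 16 * ε ^ 2 * ‖x - z‖ ^ 2)))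
      ≤ ∫ y, Real.exp (-lam * ‖y - z‖ ^ 2) ∂(stepMeasure p ε x σ) := by
  have := isProbabilityMeasure_stepMeasure hp hε x σ
  set v := x - z with hv
  set f : Space n → ℝ := fun y => Real.exp (-lam * ‖y - z‖ ^ 2) with hf
  have hfi : Integrable f (stepMeasure p ε x σ) :=
    integrable_stepMeasure_of_continuous hp hε hσ (by fun_prop)
  have hfi' : Integrable (fun y => f (x + x - y)) (stepMeasure p ε x σ) :=
    integrable_stepMeasure_of_continuous hp hε hσ (by fun_prop)
  have hqi : Integrable (fun y => (inner ℝ v (y - x)) ^ 2) (stepMeasure p ε x σ) :=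
    integrable_stepMeasure_of_continuous hp hε hσ (by fun_prop)
  have hsym : ∫ y, f y ∂(stepMeasure p ε x σ)
      = ∫ y, (f y + f (x + x - y)) / 2 ∂(stepMeasure p ε x σ) := by
    rw [integral_div, integral_add hfi hfi', integral_reflect_stepMeasure]; ring
  have hpt : ∀ᵐ y ∂(stepMeasure p ε x σ), Real.exp (-lam * ‖v‖ ^ 2) * ((1 - lam * ε ^ 2)
      * (1 + 2 * lam ^ 2 * (inner ℝ v (y - x)) ^ 2)) ≤ (f y + f (x + x - y)) / 2 := by
    filter_upwards [ae_norm_sub_le_stepMeasure hε hσ] with y hy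
    set h := y - x with hh
    have e1 : ‖y - z‖ ^ 2 = ‖v‖ ^ 2 + 2 * inner ℝ v h + ‖h‖ ^ 2 := by
      rw [← norm_add_sq_real]; congr 2; rw [hv, hh]; abel
    have e2 : ‖x + x - y - z‖ ^ 2 = ‖v‖ ^ 2 - 2 * inner ℝ v h + ‖h‖ ^ 2 := by
      rw [← norm_sub_sq_real]; congr 2; rw [hv, hh]; abel
    -- The odd cross terms of the two exponents combine into a `cosh`, whose quadratic lower bound
    -- is the source of the growth.
    have e3 : (f y + f (x + x - y)) / 2 = Real.exp (-lam * ‖v‖ ^ 2)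
        * (Real.exp (-lam * ‖h‖ ^ 2) * Real.cosh (2 * lam * inner ℝ v h)) := by
      simp only [hf]
      rw [e1, e2, Real.cosh_eq,
        show -lam * (‖v‖ ^ 2 + 2 * inner ℝ v h + ‖h‖ ^ 2)
          = -lam * ‖v‖ ^ 2 + (-lam * ‖h‖ ^ 2 + -(2 * lam * inner ℝ v h)) by ring,
        show -lam * (‖v‖ ^ 2 - 2 * inner ℝ v h + ‖h‖ ^ 2)
          = -lam * ‖v‖ ^ 2 + (-lam * ‖h‖ ^ 2 + 2 * lam * inner ℝ v h) by ring]
      simp only [Real.exp_add]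
      ring
    rw [e3]
    have h1 : 1 - lam * ε ^ 2 ≤ Real.exp (-lam * ‖h‖ ^ 2) := by
      have h2 := Real.add_one_le_exp (-lam * ‖h‖ ^ 2)
      have h3 : lam * ‖h‖ ^ 2 ≤ lam * ε ^ 2 := by gcongr
      linarith
    have h4 := one_add_sq_half_le_cosh (2 * lam * inner ℝ v h)
    have h5 : 1 + 2 * lam ^ 2 * (inner ℝ v h) ^ 2 ≤ Real.cosh (2 * lam * inner ℝ v h) := by
      refine le_trans (le_of_eq ?_) h4; ring
    have h6 : 0 ≤ 1 + 2 * lam ^ 2 * (inner ℝ v h) ^ 2 := by positivity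
    gcongr
  rw [hsym]
  refine le_trans ?_ (integral_mono_ae ?_ ((hfi.add hfi').div_const 2) hpt)
  · rw [integral_const_mul, integral_const_mul, integral_add (integrable_const _)
      (hqi.const_mul _), integral_const_mul]
    simp only [integral_const, probReal_univ, one_smul]
    have := le_integral_inner_sq_stepMeasure hp hε hσ (x := x) (σ := σ) v
    have h0 : 0 ≤ 1 - lam * ε ^ 2 := by linarith
    gcongr
  · exact (((integrable_const _).add (hqi.const_mul _)).const_mul _).const_mul _

/-- After averaging with the mirror image this is the parallelogram law: the cross term vanishes
because the step has mean zero. -/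
lemma integral_norm_add_smul_sq_stepMeasure_le (hp : 2 < p) (hε : 0 < ε) (hσ : ‖σ‖ = 1)
    (m : Space n) (θ : ℝ) :
    ∫ y, ‖m + θ • (y - x)‖ ^ 2 ∂(stepMeasure p ε x σ) ≤ ‖m‖ ^ 2 + ε ^ 2 * θ ^ 2 := by
  have := isProbabilityMeasure_stepMeasure hp hε x σ
  set f : Space n → ℝ := fun y => ‖m + θ • (y - x)‖ ^ 2 with hf
  have hfi : Integrable f (stepMeasure p ε x σ) :=
    integrable_stepMeasure_of_continuous hp hε hσ (by fun_prop)
  have hfi' : Integrable (fun y => f (x + x - y)) (stepMeasure p ε x σ) :=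
    integrable_stepMeasure_of_continuous hp hε hσ (by fun_prop)
  have hsym : ∫ y, f y ∂(stepMeasure p ε x σ)
      = ∫ y, (f y + f (x + x - y)) / 2 ∂(stepMeasure p ε x σ) := by
    rw [integral_div, integral_add hfi hfi', integral_reflect_stepMeasure]; ring
  rw [hsym]
  calc ∫ y, (f y + f (x + x - y)) / 2 ∂(stepMeasure p ε x σ)
      ≤ ∫ _, ‖m‖ ^ 2 + ε ^ 2 * θ ^ 2 ∂(stepMeasure p ε x σ) := by
        refine integral_mono_ae ((hfi.add hfi').div_const 2) (integrable_const _) ?_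
        filter_upwards [ae_norm_sub_le_stepMeasure hε hσ] with y hy
        have e : x + x - y - x = -(y - x) := by abel
        simp only [hf]
        rw [e, smul_neg, ← sub_eq_add_neg, norm_add_sq_real, norm_sub_sq_real, norm_smul,
          mul_pow, Real.norm_eq_abs, sq_abs]
        have : ‖y - x‖ ^ 2 ≤ ε ^ 2 := by gcongr
        nlinarith [sq_nonneg θ]
    _ = _ := by simp

end StepMeasure

/-! ### The barrier built from exterior balls -/

section Barrier

variable {n : ℕ} {p ε : ℝ} {Ω : Set (Space n)}

/-- The centres of the balls of radius `δ` that do not meet `Ω`. -/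
def exteriorCenters (Ω : Set (Space n)) (δ : ℝ) : Set (Space n) := {z | ∀ x ∈ Ω, δ ≤ dist x z}

lemma isClosed_exteriorCenters (δ : ℝ) : IsClosed (exteriorCenters Ω δ) := by
  have : exteriorCenters Ω δ = ⋂ x ∈ Ω, {z | δ ≤ dist x z} := by
    ext z; simp [exteriorCenters]
  rw [this]
  exact isClosed_biInter fun x _ => isClosed_le continuous_const (by fun_prop)

lemma abs_exp_neg_mul_sq_sub_le {lam : ℝ} (hlam : 0 ≤ lam) (a b : ℝ) :
    |Real.exp (-lam * a ^ 2) - Real.exp (-lam * b ^ 2)| ≤ (1 + lam) * |a - b| := by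
  have hd : ∀ s : ℝ, HasDerivAt (fun s => Real.exp (-lam * s ^ 2))
      (Real.exp (-lam * s ^ 2) * (-lam * (2 * s))) s := fun s => by
    have := (((hasDerivAt_pow 2 s).const_mul (-lam))).exp
    simpa using this
  refine Convex.norm_image_sub_le_of_norm_hasDerivWithin_le (s := Set.univ) (x := b) (y := a)
    (fun s _ => (hd s).hasDerivWithinAt) (fun s _ => ?_) convex_univ trivial trivial
  have h1 : Real.exp (-lam * s ^ 2) * (1 + lam * s ^ 2) ≤ 1 := by
    have h2 := Real.add_one_le_exp (lam * s ^ 2)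
    have h3 : Real.exp (-lam * s ^ 2) * Real.exp (lam * s ^ 2) = 1 := by
      rw [← Real.exp_add]; simp
    rw [← h3]
    gcongr
    linarith
  have h4 : |-lam * (2 * s)| ≤ (1 + lam) * (1 + lam * s ^ 2) := by
    rw [abs_le]
    have h5 : 0 ≤ lam ^ 2 * s ^ 2 := by positivity
    constructor <;> nlinarith [mul_nonneg hlam (sq_nonneg (s - 1)),
      mul_nonneg hlam (sq_nonneg (s + 1))]
  rw [Real.norm_eq_abs, abs_mul, Real.abs_exp]
  calc Real.exp (-lam * s ^ 2) * |-lam * (2 * s)|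
      ≤ Real.exp (-lam * s ^ 2) * ((1 + lam) * (1 + lam * s ^ 2)) := by gcongr
    _ = (1 + lam) * (Real.exp (-lam * s ^ 2) * (1 + lam * s ^ 2)) := by ring
    _ ≤ (1 + lam) * 1 := by gcongr
    _ = 1 + lam := mul_one _

/-- A bounded Lipschitz function `G` is a boundary barrier for `Ω` at level `b` if it is at most
`b` in `Ω`, equal to `b` on the boundary, and increases in mean by at least `c * ε ^ 2` in each
step from a point of `Ω`, whatever direction the controller chooses. -/
structure IsBarrier (p : ℝ) (Ω : Set (Space n)) (G : Space n → ℝ) (b c L ε₁ : ℝ) : Prop where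
  abs_le_one : ∀ x, |G x| ≤ 1
  lipschitz : ∀ x y, |G x - G y| ≤ L * ‖x - y‖
  le_of_mem : ∀ x ∈ Ω, G x ≤ b
  eq_of_mem_frontier : ∀ x ∈ frontier Ω, G x = b
  drift : ∀ ε, 0 < ε → ε < ε₁ → ∀ x ∈ Ω, ∀ σ : Space n, ‖σ‖ = 1 →
    G x + c * ε ^ 2 ≤ ∫ y, G y ∂(stepMeasure p ε x σ)

lemma IsBarrier.continuous {G : Space n → ℝ} {b c L ε₁ : ℝ} (hG : IsBarrier p Ω G b c L ε₁) :
    Continuous G := by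
  have hL : 0 ≤ |L| := abs_nonneg L
  refine (LipschitzWith.of_dist_le_mul (K := ⟨|L|, hL⟩) fun x y => ?_).continuous
  rw [Real.dist_eq, dist_eq_norm]
  exact (hG.lipschitz x y).trans (mul_le_mul_of_nonneg_right (le_abs_self L) (norm_nonneg _))

lemma IsGameDomain.frontier_nonempty (hn : 1 ≤ n) (hΩ : IsGameDomain Ω) :
    (frontier Ω).Nonempty := by
  have : Nontrivial (Space n) := by
    have : Nonempty (Fin n) := ⟨⟨0, hn⟩⟩
    infer_instance
  by_contra h
  rw [Set.not_nonempty_iff_eq_empty, ← isClopen_iff_frontier_eq_empty, isClopen_iff] at h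
  rcases h with h | h
  · exact hΩ.isConnected.nonempty.ne_empty h
  · have hb := hΩ.isBounded
    rw [h] at hb
    exact NormedSpace.unbounded_univ ℝ (Space n) hb

/-- The barrier is a supremum of Gaussians centred at exterior centres. At each `x` the one with
nearest centre attains it, so the drift of a single Gaussian suffices. -/
lemma exists_isBarrier (hn : 1 ≤ n) (hp : 2 < p) (hΩ : IsGameDomain Ω) :
    ∃ (G : Space n → ℝ) (b c L ε₁ : ℝ), 0 < c ∧ 0 ≤ L ∧ 0 < ε₁ ∧ IsBarrier p Ω G b c L ε₁ := by
  obtain ⟨δ, hδ, hsphere⟩ := hΩ.exteriorSphere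
  set Z := exteriorCenters Ω δ with hZ
  have hmem : ∀ y ∈ frontier Ω, ∃ z ∈ Z, dist y z ≤ δ := by
    intro y hy
    obtain ⟨z, hz1, hz2⟩ := hsphere y hy
    refine ⟨z, fun x hx => ?_, ?_⟩
    · by_contra! h
      exact hz1 (Metric.mem_ball.2 h) hx
    · have : y ∈ Metric.closedBall z δ ∩ closure Ω := hz2 ▸ Set.mem_singleton y
      exact this.1
  obtain ⟨y₀, hy₀⟩ := hΩ.frontier_nonempty hn
  obtain ⟨z₀, hz₀, -⟩ := hmem y₀ hy₀
  have hZne : Z.Nonempty := ⟨z₀, hz₀⟩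
  have hZcl : IsClosed Z := isClosed_exteriorCenters δ
  obtain ⟨R, hR⟩ := (Metric.isBounded_iff_subset_closedBall z₀).1 hΩ.isBounded
  have hβ := coinBeta_pos n hp
  set κ := coinBeta n p / 4 ^ n / 16 with hκ
  have hκ0 : 0 < κ := by positivity
  -- With `q = lam * ε ^ 2`, this choice makes the gain from the noise at least `4 * q` for `‖x - z‖
  -- ≥ δ`. Then `(1 - q) * (1 + 4 * q) ≥ 1 + q` as soon as `q ≤ 1 / 2`, which the threshold `min 1
  -- (1 / (2 * lam))` for `ε` ensures.
  set lam := 2 / (κ * δ ^ 2) with hlam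
  have hlam0 : 0 < lam := by positivity
  have hlk : 2 * lam * κ * δ ^ 2 = 4 := by rw [hlam]; field_simp; norm_num
  have hdclosure : ∀ x ∈ closure Ω, δ ≤ Metric.infDist x Z := by
    have hcl : IsClosed {x : Space n | δ ≤ Metric.infDist x Z} :=
      isClosed_le continuous_const (Metric.continuous_infDist_pt Z)
    refine fun x hx => closure_minimal (fun x hx => ?_) hcl hx
    exact (Metric.le_infDist hZne).2 fun z hz => hz x hx
  refine ⟨fun x => Real.exp (-lam * Metric.infDist x Z ^ 2), Real.exp (-lam * δ ^ 2),
    lam * Real.exp (-lam * R ^ 2), 1 + lam, min 1 (1 / (2 * lam)), by positivity, by positivity,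
    by positivity, ⟨fun x => ?_, fun x y => ?_, fun x hx => ?_, fun x hx => ?_, ?_⟩⟩
  · rw [Real.abs_exp, Real.exp_le_one_iff, neg_mul, neg_nonpos]
    positivity
  · refine (abs_exp_neg_mul_sq_sub_le hlam0.le _ _).trans ?_
    gcongr
    rw [abs_le, ← dist_eq_norm]
    have h1 := Metric.infDist_le_infDist_add_dist (s := Z) (x := x) (y := y)
    have h2 := Metric.infDist_le_infDist_add_dist (s := Z) (x := y) (y := x)
    rw [dist_comm y x] at h2
    constructor <;> linarith
  · have := hdclosure x (subset_closure hx)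
    rw [Real.exp_le_exp, neg_mul, neg_mul, neg_le_neg_iff]
    gcongr
  · have h1 := hdclosure x (frontier_subset_closure hx)
    obtain ⟨z, hz, hxz⟩ := hmem x hx
    have h2 := (Metric.infDist_le_dist_of_mem hz).trans hxz
    simp only [le_antisymm h2 h1]
  · intro ε hε hε1 x hx σ hσ
    have := isProbabilityMeasure_stepMeasure hp hε x σ
    obtain ⟨z, hz, hxz⟩ := hZcl.exists_infDist_eq_dist hZne x
    have hδz : δ ≤ ‖x - z‖ := by rw [← dist_eq_norm]; exact hz x hx
    -- The distance to the nearest centre is at most that to `z₀`, so the gain `lam * exp (-lam * ‖x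
    -- - z‖ ^ 2) * ε ^ 2` is bounded below uniformly on `Ω`.
    have hxR : ‖x - z‖ ≤ R := by
      rw [← dist_eq_norm, ← hxz]
      exact (Metric.infDist_le_dist_of_mem hz₀).trans (hR hx)
    have hq : lam * ε ^ 2 ≤ 1 / 2 := by
      have h1 : ε < 1 := hε1.trans_le (min_le_left _ _)
      have h2 : ε < 1 / (2 * lam) := hε1.trans_le (min_le_right _ _)
      calc lam * ε ^ 2 ≤ lam * ε := by gcongr; nlinarith
        _ ≤ lam * (1 / (2 * lam)) := by gcongr
        _ = 1 / 2 := by field_simp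
    have hgauss := le_integral_gaussian_stepMeasure (x := x) (σ := σ) hp hε hσ hlam0.le
      (hq.trans (by norm_num)) z
    rw [← hκ] at hgauss
    have hfac : 1 + lam * ε ^ 2 ≤ (1 - lam * ε ^ 2)
        * (1 + 2 * lam ^ 2 * (κ * ε ^ 2 * ‖x - z‖ ^ 2)) := by
      have h1 : 4 * (lam * ε ^ 2) ≤ 2 * lam ^ 2 * (κ * ε ^ 2 * ‖x - z‖ ^ 2) := by
        calc 4 * (lam * ε ^ 2) = 2 * lam ^ 2 * (κ * ε ^ 2 * δ ^ 2) := by rw [← hlk]; ring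
          _ ≤ _ := by gcongr
      have h0 : 0 ≤ lam * ε ^ 2 := by positivity
      nlinarith
    -- The Gaussian centred at `z` lies below the barrier and touches it at `x`.
    have hmono : ∫ y, Real.exp (-lam * ‖y - z‖ ^ 2) ∂(stepMeasure p ε x σ)
        ≤ ∫ y, Real.exp (-lam * Metric.infDist y Z ^ 2) ∂(stepMeasure p ε x σ) := by
      have hc := Metric.continuous_infDist_pt Z
      refine integral_mono (integrable_stepMeasure_of_continuous hp hε hσ (by fun_prop))
        (integrable_stepMeasure_of_continuous hp hε hσ (by fun_prop)) fun y => ?_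
      have h1 := Metric.infDist_le_dist_of_mem (x := y) hz
      rw [dist_eq_norm] at h1
      have h2 : 0 ≤ Metric.infDist y Z := Metric.infDist_nonneg
      simp only [Real.exp_le_exp, neg_mul, neg_le_neg_iff]
      gcongr
    refine le_trans ?_ hmono
    refine le_trans ?_ hgauss
    rw [hxz, dist_eq_norm]
    calc Real.exp (-lam * ‖x - z‖ ^ 2) + lam * Real.exp (-lam * R ^ 2) * ε ^ 2
        ≤ Real.exp (-lam * ‖x - z‖ ^ 2) + lam * Real.exp (-lam * ‖x - z‖ ^ 2) * ε ^ 2 := by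
          have : -lam * R ^ 2 ≤ -lam * ‖x - z‖ ^ 2 := by
            rw [neg_mul, neg_mul, neg_le_neg_iff]; gcongr
          gcongr
      _ = Real.exp (-lam * ‖x - z‖ ^ 2) * (1 + lam * ε ^ 2) := by ring
      _ ≤ _ := by gcongr

end Barrier

/-! ### The path law: conditioning and translation -/

section PathLaw

variable {n : ℕ} {p ε : ℝ} (hp : 2 < p) (hε : 0 < ε) (S : Strategy n) (P : Space n × ℝ)

/-- The direction chosen in round `k` along the path `ω`. -/
def Strategy.dirAt (S : Strategy n) (t₀ : ℝ) (k : ℕ) (ω : ℕ → Space n) : Space n :=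
  S.dir k t₀ (Preorder.frestrictLe k ω)

lemma Strategy.norm_dirAt (S : Strategy n) (t₀ : ℝ) (k : ℕ) (ω : ℕ → Space n) :
    ‖S.dirAt t₀ k ω‖ = 1 := S.norm_dir _ _ _

instance : IsProbabilityMeasure (gameMeasure hp hε S P) := by
  unfold gameMeasure; infer_instance

/-- With the law of the starting position, this recursion determines the whole path law. -/
lemma map_frestrictLe_prodMk_gameMeasure (k : ℕ) :
    (gameMeasure hp hε S P).map
        (fun ω => (Preorder.frestrictLe (π := fun _ => Space n) k ω, ω (k + 1)))
      = ((gameMeasure hp hε S P).map (Preorder.frestrictLe (π := fun _ => Space n) k))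
        ⊗ₘ stepKernel hp hε S P.2 k := by
  unfold gameMeasure
  rw [Kernel.traj_map_frestrictLe_apply,
    ← Kernel.partialTraj_compProd_eq_map_traj (Nat.zero_le k)]

lemma map_frestrictLe_zero_gameMeasure :
    (gameMeasure hp hε S P).map (Preorder.frestrictLe (π := fun _ => Space n) 0)
      = Measure.dirac (fun _ => P.1) := by
  unfold gameMeasure
  rw [Kernel.traj_map_frestrictLe_apply, Kernel.partialTraj_self, Kernel.id_apply]

lemma ae_zero_eq_gameMeasure : ∀ᵐ ω ∂(gameMeasure hp hε S P), ω 0 = P.1 := by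
  have h : ∀ᵐ h ∂((gameMeasure hp hε S P).map (Preorder.frestrictLe (π := fun _ => Space n) 0)),
      h ⟨0, Finset.mem_Iic.2 le_rfl⟩ = P.1 := by
    have hs : MeasurableSet {h : Finset.Iic 0 → Space n |
        h ⟨0, Finset.mem_Iic.2 le_rfl⟩ = P.1} :=
      measurableSet_eq_fun (measurable_pi_apply _) measurable_const
    rw [map_frestrictLe_zero_gameMeasure, ae_dirac_iff hs]
  exact ae_of_ae_map (by fun_prop) h

lemma ae_norm_sub_le_gameMeasure :
    ∀ᵐ ω ∂(gameMeasure hp hε S P), ∀ k, ‖ω (k + 1) - ω k‖ ≤ ε := by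
  rw [ae_all_iff]
  intro k
  have hs : MeasurableSet {q : (Finset.Iic k → Space n) × Space n |
      ‖q.2 - q.1 ⟨k, Finset.mem_Iic.2 le_rfl⟩‖ ≤ ε} :=
    (isClosed_le (by fun_prop) continuous_const).measurableSet
  have h : ∀ᵐ q ∂((gameMeasure hp hε S P).map
      (fun ω => (Preorder.frestrictLe (π := fun _ => Space n) k ω, ω (k + 1)))),
      ‖q.2 - q.1 ⟨k, Finset.mem_Iic.2 le_rfl⟩‖ ≤ ε := by
    rw [map_frestrictLe_prodMk_gameMeasure, Measure.ae_compProd_iff hs]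
    exact ae_of_all _ fun h => ae_norm_sub_le_stepMeasure hε (S.norm_dir _ _ _)
  exact ae_of_ae_map (by fun_prop) h

/-- The path that follows the history `h` and rests afterwards. -/
def restPath {k : ℕ} (h : Finset.Iic k → Space n) (j : ℕ) : Space n :=
  h ⟨min j k, Finset.mem_Iic.2 (min_le_right _ _)⟩

lemma measurable_restPath (k : ℕ) :
    Measurable (restPath : (Finset.Iic k → Space n) → ℕ → Space n) :=
  measurable_pi_lambda _ fun _ => measurable_pi_apply _

variable {hp hε S P}

/-- If, given the history up to round `k`, the conditional mean of `Φ` is at most `Ψ`, then so it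
is in total mean. -/
lemma integral_step_le {k : ℕ} {Φ : (ℕ → Space n) → Space n → ℝ} {Ψ : (ℕ → Space n) → ℝ}
    (hΦ : Measurable (Function.uncurry Φ))
    (hdep : ∀ ω ω' : ℕ → Space n, (∀ j ≤ k, ω j = ω' j) → Φ ω = Φ ω')
    (hΦi : Integrable (fun ω => Φ ω (ω (k + 1))) (gameMeasure hp hε S P))
    (hΨi : Integrable Ψ (gameMeasure hp hε S P))
    (hle : ∀ ω, ∫ y, Φ ω y ∂(stepMeasure p ε (ω k) (S.dirAt P.2 k ω)) ≤ Ψ ω) :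
    ∫ ω, Φ ω (ω (k + 1)) ∂(gameMeasure hp hε S P) ≤ ∫ ω, Ψ ω ∂(gameMeasure hp hε S P) := by
  set μ := gameMeasure hp hε S P with hμ
  set g : (Finset.Iic k → Space n) × Space n → ℝ := fun q => Φ (restPath q.1) q.2 with hg
  have hgm : Measurable g :=
    hΦ.comp (((measurable_restPath k).comp measurable_fst).prodMk measurable_snd)
  -- `Φ` sees only the rounds up to `k`, so the resting path may replace `ω`; this turns `Φ` into a
  -- function of the finite history.
  have hrest : ∀ ω : ℕ → Space n,
      Φ (restPath (Preorder.frestrictLe (π := fun _ => Space n) k ω)) = Φ ω :=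
    fun ω => hdep _ _ fun j hj => by simp [restPath, hj]
  have hT : Measurable
      (fun ω : ℕ → Space n => (Preorder.frestrictLe (π := fun _ => Space n) k ω, ω (k + 1))) := by
    fun_prop
  have hgT : ∀ ω : ℕ → Space n,
      g (Preorder.frestrictLe (π := fun _ => Space n) k ω, ω (k + 1)) = Φ ω (ω (k + 1)) :=
    fun ω => by simp only [hg, hrest]
  have hint : Integrable g ((μ.map (Preorder.frestrictLe (π := fun _ => Space n) k))
      ⊗ₘ stepKernel hp hε S P.2 k) := by
    rw [← map_frestrictLe_prodMk_gameMeasure, integrable_map_measure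
      hgm.aestronglyMeasurable hT.aemeasurable]
    exact hΦi.congr (ae_of_all _ fun ω => (hgT ω).symm)
  have hinner : Integrable (fun h => ∫ y, g (h, y) ∂(stepKernel hp hε S P.2 k h))
      (μ.map (Preorder.frestrictLe (π := fun _ => Space n) k)) := hint.integral_compProd
  have hinnerm := hinner.aestronglyMeasurable
  rw [integrable_map_measure hinner.aestronglyMeasurable (by fun_prop)] at hinner
  calc ∫ ω, Φ ω (ω (k + 1)) ∂μ
      = ∫ q, g q ∂((μ.map (Preorder.frestrictLe (π := fun _ => Space n) k))
          ⊗ₘ stepKernel hp hε S P.2 k) := by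
        rw [← map_frestrictLe_prodMk_gameMeasure, integral_map hT.aemeasurable
          hgm.aestronglyMeasurable]
        exact integral_congr_ae (ae_of_all _ fun ω => (hgT ω).symm)
    _ = ∫ ω, ∫ y, g (Preorder.frestrictLe (π := fun _ => Space n) k ω, y)
          ∂(stepKernel hp hε S P.2 k (Preorder.frestrictLe (π := fun _ => Space n) k ω)) ∂μ := by
        rw [Measure.integral_compProd hint, integral_map (by fun_prop) hinnerm]
    _ ≤ ∫ ω, Ψ ω ∂μ := by
        refine integral_mono hinner hΨi fun ω => ?_
        simp only [hg, hrest]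
        exact hle ω

/-- The strategy `S` moved along the space-time translation by `(ξ, s)`. -/
def Strategy.translate (S : Strategy n) (ξ : Space n) (s : ℝ) : Strategy n where
  dir k t₀ h := S.dir k (t₀ - s) (fun j => h j - ξ)
  measurable_dir k := by
    have h : Measurable fun q : ℝ × (Finset.Iic k → Space n) =>
        (q.1 - s, (fun j => q.2 j - ξ : Finset.Iic k → Space n)) := by fun_prop
    exact (S.measurable_dir k).comp h
  norm_dir k t₀ h := S.norm_dir _ _ _

/-- Extension of a history by one position. -/
def snocHistory {k : ℕ} (q : (Finset.Iic k → Space n) × Space n) :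
    Finset.Iic (k + 1) → Space n :=
  fun j => if h : (j : ℕ) ≤ k then q.1 ⟨j, Finset.mem_Iic.2 h⟩ else q.2

lemma measurable_snocHistory {k : ℕ} :
    Measurable (snocHistory : (Finset.Iic k → Space n) × Space n → _) := by
  refine measurable_pi_lambda _ fun j => ?_
  by_cases h : (j : ℕ) ≤ k
  · simp only [snocHistory, h, dite_true]
    exact (measurable_pi_apply _).comp measurable_fst
  · simp only [snocHistory, h, dite_false]
    exact measurable_snd

lemma snocHistory_frestrictLe (k : ℕ) (ω : ℕ → Space n) :
    snocHistory (Preorder.frestrictLe (π := fun _ => Space n) k ω, ω (k + 1))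
      = Preorder.frestrictLe (π := fun _ => Space n) (k + 1) ω := by
  ext1 j
  by_cases h : (j : ℕ) ≤ k
  · simp [snocHistory, h]
  · have hj : (j : ℕ) = k + 1 := by
      have := Finset.mem_Iic.1 j.2
      omega
    simp [snocHistory, hj]

lemma measure_ext_of_map_frestrictLe {μ ν : Measure (ℕ → Space n)} [IsFiniteMeasure μ]
    (h : ∀ k, μ.map (Preorder.frestrictLe (π := fun _ => Space n) k)
      = ν.map (Preorder.frestrictLe (π := fun _ => Space n) k)) : μ = ν := by
  have h2 : IsProjectiveLimit μ (fun I : Finset ℕ => μ.map I.restrict) := fun I => rfl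
  refine h2.unique fun I => ?_
  have hI : I.restrict (π := fun _ : ℕ => Space n)
      = (Finset.restrict₂ (π := fun _ : ℕ => Space n) I.subset_Iic_sup_id)
        ∘ (Preorder.frestrictLe (π := fun _ : ℕ => Space n) (I.sup id)) := rfl
  have hm : Measurable (Finset.restrict₂ (π := fun _ : ℕ => Space n) I.subset_Iic_sup_id) :=
    Finset.measurable_restrict₂ _
  simp only [hI]
  rw [← Measure.map_map hm (by fun_prop), ← Measure.map_map hm (by fun_prop), h]

/-- Induction on the length of the history: the translated strategy, fed with the shifted history,
returns the original direction, and the step law commutes with translations. -/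
lemma gameMeasure_translate (ξ : Space n) (s : ℝ) :
    gameMeasure hp hε (S.translate ξ s) (P.1 + ξ, P.2 + s)
      = (gameMeasure hp hε S P).map (fun ω k => ω k + ξ) := by
  set ν := gameMeasure hp hε (S.translate ξ s) (P.1 + ξ, P.2 + s) with hν
  set μ := gameMeasure hp hε S P with hμ
  have hsh : Measurable fun (ω : ℕ → Space n) k => ω k + ξ := by fun_prop
  refine measure_ext_of_map_frestrictLe fun k => ?_
  have hshk : ∀ k : ℕ, Measurable fun (h : Finset.Iic k → Space n) j => h j + ξ := fun k => by
    fun_prop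
  have hcomm : ∀ k : ℕ, (Preorder.frestrictLe (π := fun _ => Space n) k) ∘
      (fun (ω : ℕ → Space n) j => ω j + ξ)
      = (fun (h : Finset.Iic k → Space n) j => h j + ξ)
        ∘ (Preorder.frestrictLe (π := fun _ => Space n) k) := fun k => rfl
  rw [Measure.map_map (by fun_prop) hsh, hcomm, ← Measure.map_map (hshk k) (by fun_prop)]
  induction k with
  | zero =>
    rw [hν, hμ, map_frestrictLe_zero_gameMeasure, map_frestrictLe_zero_gameMeasure,
      Measure.map_dirac' (hshk 0)]
  | succ k ih =>
    have hsucc : ∀ m : Measure (ℕ → Space n),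
        m.map (Preorder.frestrictLe (π := fun _ => Space n) (k + 1))
          = (m.map (fun ω => (Preorder.frestrictLe (π := fun _ => Space n) k ω, ω (k + 1)))).map
            snocHistory := fun m => by
      rw [Measure.map_map measurable_snocHistory (by fun_prop)]
      congr 1
      ext1 ω
      exact (snocHistory_frestrictLe k ω).symm
    rw [hsucc ν, hsucc μ, hν, hμ, map_frestrictLe_prodMk_gameMeasure,
      map_frestrictLe_prodMk_gameMeasure, ← hν, ← hμ, ih,
      Measure.map_map (hshk (k + 1)) measurable_snocHistory]
    have hcomm' : (fun (h : Finset.Iic (k + 1) → Space n) j => h j + ξ) ∘ snocHistory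
        = snocHistory ∘ (fun q : (Finset.Iic k → Space n) × Space n =>
          ((fun j => q.1 j + ξ), q.2 + ξ)) := by
      ext1 q
      ext1 j
      by_cases h : (j : ℕ) ≤ k <;> simp [snocHistory, h]
    have hshq : Measurable (fun q : (Finset.Iic k → Space n) × Space n =>
        ((fun j => q.1 j + ξ : Finset.Iic k → Space n), q.2 + ξ)) := by fun_prop
    rw [hcomm', ← Measure.map_map measurable_snocHistory hshq]
    congr 1
    refine Measure.ext_of_lintegral _ fun f hf => ?_
    have hf' : Measurable fun q : (Finset.Iic k → Space n) × Space n =>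
        f ((fun j => q.1 j + ξ), q.2 + ξ) := hf.comp hshq
    rw [lintegral_map hf hshq, Measure.lintegral_compProd hf, Measure.lintegral_compProd hf',
      lintegral_map hf.lintegral_kernel_prod_right'
        (hshk k)]
    refine lintegral_congr fun h => ?_
    have hker : stepKernel hp hε (S.translate ξ s) (P.1 + ξ, P.2 + s).2 k (fun j => h j + ξ)
        = stepMeasure p ε (h ⟨k, Finset.mem_Iic.2 le_rfl⟩ + ξ) (S.dir k P.2 h) := by
      simp [stepKernel, Strategy.translate]
    rw [hker]
    exact (lintegral_add_right_stepMeasure ξ (f := fun y => f ((fun j => h j + ξ), y))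
      (hf.comp measurable_prodMk_left)).symm

end PathLaw

/-! ### Values of the barrier near the boundary -/

section Boundary

variable {n : ℕ} {p ε : ℝ} {Ω : Set (Space n)} {G : Space n → ℝ} {b c L ε₁ : ℝ}

lemma exists_frontier_dist_le (hne : Ω.Nonempty) {x : Space n} (hx : x ∉ Ω)
    (hε : Metric.infDist x Ω ≤ ε) : ∃ y ∈ frontier Ω, dist x y ≤ ε := by
  have hu : Ωᶜ ≠ Set.univ := by
    intro h
    rw [Set.compl_univ_iff] at h
    exact hne.ne_empty h
  obtain ⟨y, hy, hxy⟩ := exists_mem_frontier_infDist_compl_eq_dist (s := Ωᶜ) hx hu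
  rw [frontier_compl] at hy
  rw [compl_compl] at hxy
  exact ⟨y, hy, hxy ▸ hε⟩

lemma IsBarrier.le_of_infDist_le (hG : IsBarrier p Ω G b c L ε₁) (hL : 0 ≤ L) (hε : 0 ≤ ε)
    (hne : Ω.Nonempty) {x : Space n} (hx : Metric.infDist x Ω ≤ ε) : G x ≤ b + L * ε := by
  by_cases hxΩ : x ∈ Ω
  · have := hG.le_of_mem x hxΩ
    have : 0 ≤ L * ε := by positivity
    linarith
  · obtain ⟨y, hy, hxy⟩ := exists_frontier_dist_le hne hxΩ hx
    have h1 := (abs_le.1 (hG.lipschitz x y)).2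
    rw [hG.eq_of_mem_frontier y hy, ← dist_eq_norm] at h1
    have : L * dist x y ≤ L * ε := by gcongr
    linarith

/-- The lower bound needs `x ∉ Ω`: deep inside `Ω` the barrier may be far below `b`. -/
lemma IsBarrier.le_of_notMem (hG : IsBarrier p Ω G b c L ε₁) (hL : 0 ≤ L)
    (hne : Ω.Nonempty) {x : Space n} (hxΩ : x ∉ Ω) (hx : Metric.infDist x Ω ≤ ε) :
    b - L * ε ≤ G x := by
  obtain ⟨y, hy, hxy⟩ := exists_frontier_dist_le hne hxΩ hx
  have h1 := (abs_le.1 (hG.lipschitz x y)).1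
  rw [hG.eq_of_mem_frontier y hy, ← dist_eq_norm] at h1
  have : L * dist x y ≤ L * ε := by gcongr
  linarith

end Boundary

/-! ### Exit rounds with a time horizon -/

section ExitRound

variable {n : ℕ} {A : Set (Space n)} {K k : ℕ} {ω : ℕ → Space n}

/-- The first round in which the path is outside `A`, and at most `K`. -/
noncomputable def exitRound (A : Set (Space n)) (K : ℕ) (ω : ℕ → Space n) : ℕ :=
  sInf {k | ω k ∉ A ∨ K ≤ k}

lemma exitRound_le : exitRound A K ω ≤ K := Nat.sInf_le (Or.inr le_rfl)

lemma notMem_or_le_exitRound : ω (exitRound A K ω) ∉ A ∨ K ≤ exitRound A K ω :=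
  Nat.sInf_mem (s := {k | ω k ∉ A ∨ K ≤ k}) ⟨K, Or.inr le_rfl⟩

/-- The stopping time property: whether the game still runs after round `k` is read off from the
first `k + 1` positions. -/
lemma lt_exitRound_iff : k < exitRound A K ω ↔ ∀ j ≤ k, ω j ∈ A ∧ j < K := by
  refine ⟨fun h j hj => ?_, fun h => ?_⟩
  · have := Nat.notMem_of_lt_sInf (lt_of_le_of_lt hj h)
    simpa using this
  · by_contra! hle
    obtain ⟨h1, h2⟩ := h _ hle
    rcases notMem_or_le_exitRound (A := A) (K := K) (ω := ω) with h3 | h3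
    · exact h3 h1
    · omega

lemma notMem_of_exitRound_lt (h : exitRound A K ω < K) : ω (exitRound A K ω) ∉ A :=
  notMem_or_le_exitRound.resolve_right (not_le.2 h)

lemma exitRound_le_add (A : Set (Space n)) (K K' : ℕ) (ω : ℕ → Space n) :
    exitRound A K' ω ≤ exitRound A K ω + (K' - K) := by
  rcases notMem_or_le_exitRound (A := A) (K := K) (ω := ω) with h | h
  · exact (Nat.sInf_le (Or.inl h)).trans le_self_add
  · have := exitRound_le (A := A) (K := K') (ω := ω)
    omega

lemma measurableSet_lt_exitRound (hA : MeasurableSet A) (K k : ℕ) :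
    MeasurableSet {ω : ℕ → Space n | k < exitRound A K ω} := by
  have : {ω : ℕ → Space n | k < exitRound A K ω}
      = ⋂ j, ⋂ (_ : j ≤ k), {ω | ω j ∈ A} ∩ {_ω | j < K} := by
    ext ω
    simp [lt_exitRound_iff]
  rw [this]
  exact MeasurableSet.iInter fun j => MeasurableSet.iInter fun _ =>
    (measurable_pi_apply j hA).inter (MeasurableSet.const _)

lemma measurable_exitRound (hA : MeasurableSet A) (K : ℕ) :
    Measurable (exitRound A K) :=
  measurable_of_Ioi fun k => measurableSet_lt_exitRound hA K k

lemma lt_exitRound_congr {ω' : ℕ → Space n} (h : ∀ j ≤ k, ω j = ω' j) :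
    k < exitRound A K ω ↔ k < exitRound A K ω' := by
  rw [lt_exitRound_iff, lt_exitRound_iff]
  exact forall₂_congr fun j hj => by rw [h j hj]

/-- Up to the exit round, a path with steps of length at most `ε` stays `ε`-close to the set. -/
lemma infDist_le_of_le_exitRound {Ω : Set (Space n)} {a : Space n} {ε : ℝ} (hε : 0 ≤ ε)
    (h0 : ω 0 + a ∈ closure Ω) (hω : ∀ k, ‖ω (k + 1) - ω k‖ ≤ ε) {j : ℕ}
    (hj : j ≤ exitRound {x | x + a ∈ Ω} K ω) : Metric.infDist (ω j + a) Ω ≤ ε := by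
  rcases j with _ | j
  · rw [Metric.infDist_zero_of_mem_closure h0]; exact hε
  · have h1 : ω j + a ∈ Ω := (lt_exitRound_iff.1 (Nat.lt_of_succ_le hj) j le_rfl).1
    refine (Metric.infDist_le_dist_of_mem h1).trans ?_
    rw [dist_eq_norm, add_sub_add_right_eq_sub]
    exact hω j

/-- The indicator of `k < m`. -/
def before (m k : ℕ) : ℝ := if k < m then 1 else 0

/-- Writes a stopped quantity as a sum over a deterministic range, so that sums and integrals can be
exchanged. -/
lemma sum_before_smul_sub {E : Type*} [AddCommGroup E] [Module ℝ E] {m N : ℕ} (h : m ≤ N)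
    (f : ℕ → E) :
    ∑ k ∈ Finset.range N, before m k • (f (k + 1) - f k) = f m - f 0 := by
  rw [← Finset.sum_range_sub, ← Finset.sum_subset (Finset.range_mono h)]
  · refine Finset.sum_congr rfl fun k hk => ?_
    simp [before, Finset.mem_range.1 hk]
  · intro k _ hk
    simp [before, Finset.mem_range.not.1 hk]

lemma sum_before {m N : ℕ} (h : m ≤ N) : ∑ k ∈ Finset.range N, before m k = m := by
  simpa using sum_before_smul_sub h (fun k => (k : ℝ))

lemma abs_before_sub_before_le (m m' k : ℕ) : |before m k - before m' k| ≤ 1 := by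
  unfold before; split_ifs <;> norm_num

lemma sq_before_sub_before (m m' k : ℕ) :
    (before m k - before m' k) ^ 2 = before (max m m') k - before (min m m') k := by
  unfold before; split_ifs <;> first | omega | norm_num

lemma sum_sq_before_sub_before {m m' N : ℕ} (h : m ≤ N) (h' : m' ≤ N) :
    ∑ k ∈ Finset.range N, (before m k - before m' k) ^ 2 = |(m : ℝ) - m'| := by
  simp only [sq_before_sub_before, Finset.sum_sub_distrib]
  rw [sum_before (max_le h h'), sum_before (min_le_of_left_le h), Nat.cast_max, Nat.cast_min,
    max_sub_min_eq_abs, abs_sub_comm]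

lemma measurable_before_comp {f : (ℕ → Space n) → ℕ} (hf : Measurable f) (k : ℕ) :
    Measurable fun ω => before (f ω) k :=
  (measurable_of_countable fun m => before m k).comp hf

end ExitRound

/-! ### Martingale estimates for stopped paths -/

section Martingale

variable {n : ℕ} {p ε : ℝ} {hp : 2 < p} {hε : 0 < ε} {S : Strategy n} {P : Space n × ℝ}

/-- The increments of the path weighted by `θ`, summed over the rounds before `k`. -/
noncomputable def pathTransform (θ : ℕ → (ℕ → Space n) → ℝ) (k : ℕ) (ω : ℕ → Space n) : Space n :=
  ∑ j ∈ Finset.range k, θ j ω • (ω (j + 1) - ω j)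

lemma measurable_pathTransform {θ : ℕ → (ℕ → Space n) → ℝ} (hθ : ∀ k, Measurable (θ k)) (k : ℕ) :
    Measurable (pathTransform θ k) := by
  unfold pathTransform
  exact Finset.measurable_sum _ fun j _ => (hθ j).smul (by fun_prop)

lemma integrable_norm_pathTransform_sq {θ : ℕ → (ℕ → Space n) → ℝ} (hθ : ∀ k, Measurable (θ k))
    (hθ1 : ∀ k ω, |θ k ω| ≤ 1) (k : ℕ) :
    Integrable (fun ω => ‖pathTransform θ k ω‖ ^ 2) (gameMeasure hp hε S P) := by
  refine Integrable.of_bound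
    (((measurable_pathTransform hθ k).norm.pow_const 2).aestronglyMeasurable) ((k * ε) ^ 2) ?_
  filter_upwards [ae_norm_sub_le_gameMeasure hp hε S P] with ω hω
  rw [norm_pow, norm_norm]
  gcongr
  unfold pathTransform
  refine (norm_sum_le _ _).trans ((Finset.sum_le_card_nsmul _ _ ε fun j _ => ?_).trans ?_)
  · rw [norm_smul, Real.norm_eq_abs]
    calc |θ j ω| * ‖ω (j + 1) - ω j‖ ≤ 1 * ε :=
          mul_le_mul (hθ1 j ω) (hω j) (norm_nonneg _) zero_le_one
      _ = ε := one_mul ε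
  · simp

/-- Orthogonality of martingale increments, added one round at a time; `hdep` says that the weight
of a round is known before its step. -/
lemma integral_norm_pathTransform_sq_le {θ : ℕ → (ℕ → Space n) → ℝ}
    (hθ : ∀ k, Measurable (θ k)) (hθ1 : ∀ k ω, |θ k ω| ≤ 1)
    (hdep : ∀ (k : ℕ) (ω ω' : ℕ → Space n), (∀ j ≤ k, ω j = ω' j) → θ k ω = θ k ω') (N : ℕ) :
    ∫ ω, ‖pathTransform θ N ω‖ ^ 2 ∂(gameMeasure hp hε S P)
      ≤ ε ^ 2 * ∫ ω, ∑ k ∈ Finset.range N, θ k ω ^ 2 ∂(gameMeasure hp hε S P) := by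
  have hsq : ∀ k, Integrable (fun ω => θ k ω ^ 2) (gameMeasure hp hε S P) := fun k => by
    refine Integrable.of_bound ((hθ k).pow_const 2).aestronglyMeasurable 1 (ae_of_all _ fun ω => ?_)
    rw [norm_pow, Real.norm_eq_abs]
    exact pow_le_one₀ (abs_nonneg _) (hθ1 k ω)
  rw [integral_finsetSum _ fun k _ => hsq k]
  induction N with
  | zero => simp [pathTransform]
  | succ k ih =>
    have hsucc : ∀ ω, pathTransform θ (k + 1) ω
        = pathTransform θ k ω + θ k ω • (ω (k + 1) - ω k) := fun ω =>
      Finset.sum_range_succ _ _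
    have hi := integrable_norm_pathTransform_sq (hp := hp) (hε := hε) (S := S) (P := P) hθ hθ1
    have hik := hi (k + 1)
    simp only [hsucc] at hik ⊢
    let Φ : (ℕ → Space n) → Space n → ℝ := fun ω y =>
      ‖pathTransform θ k ω + θ k ω • (y - ω k)‖ ^ 2
    let Ψ : (ℕ → Space n) → ℝ := fun ω => ‖pathTransform θ k ω‖ ^ 2 + ε ^ 2 * θ k ω ^ 2
    have hΦ : Measurable (Function.uncurry Φ) := by
      have h1 := measurable_pathTransform hθ k
      have h2 := hθ k
      have h3 : Measurable fun ω : ℕ → Space n => ω k := measurable_pi_apply k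
      exact (((h1.comp measurable_fst).add ((h2.comp measurable_fst).smul
        (measurable_snd.sub (h3.comp measurable_fst)))).norm).pow_const 2
    have hΦdep : ∀ ω ω' : ℕ → Space n, (∀ j ≤ k, ω j = ω' j) → Φ ω = Φ ω' := by
      intro ω ω' h
      have h1 : pathTransform θ k ω = pathTransform θ k ω' := by
        refine Finset.sum_congr rfl fun j hj => ?_
        have hjk := Finset.mem_range.1 hj
        rw [h (j + 1) hjk, h j hjk.le, hdep j ω ω' fun i hi => h i (hi.trans hjk.le)]
      ext1 y
      simp only [Φ, h1, hdep k ω ω' h, h k le_rfl]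
    have hle : ∀ ω, ∫ y, Φ ω y ∂(stepMeasure p ε (ω k) (S.dirAt P.2 k ω)) ≤ Ψ ω := fun ω =>
      integral_norm_add_smul_sq_stepMeasure_le hp hε (S.norm_dirAt P.2 k ω) _ _
    have hstep : ∫ ω, Φ ω (ω (k + 1)) ∂(gameMeasure hp hε S P)
        ≤ ∫ ω, Ψ ω ∂(gameMeasure hp hε S P) :=
      integral_step_le hΦ hΦdep hik ((hi k).add ((hsq k).const_mul _)) hle
    have hΨ : ∫ ω, Ψ ω ∂(gameMeasure hp hε S P)
        = ∫ ω, ‖pathTransform θ k ω‖ ^ 2 ∂(gameMeasure hp hε S P)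
          + ε ^ 2 * ∫ ω, θ k ω ^ 2 ∂(gameMeasure hp hε S P) := by
      rw [integral_add (hi k) ((hsq k).const_mul _), integral_const_mul]
    rw [Finset.sum_range_succ, mul_add]
    refine hstep.trans ?_
    rw [hΨ]
    gcongr

lemma pathTransform_before_sub (A A' : Set (Space n)) (K K' : ℕ) (ω : ℕ → Space n) :
    pathTransform (fun k ω => before (exitRound A K ω) k - before (exitRound A' K' ω) k)
      (max K K') ω = ω (exitRound A K ω) - ω (exitRound A' K' ω) := by
  simp only [pathTransform, sub_smul, Finset.sum_sub_distrib]
  rw [sum_before_smul_sub (exitRound_le.trans (le_max_left _ _)),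
    sum_before_smul_sub (exitRound_le.trans (le_max_right _ _)), sub_sub_sub_cancel_right]

lemma measurable_before_sub {A A' : Set (Space n)} (hA : MeasurableSet A)
    (hA' : MeasurableSet A') (K K' k : ℕ) :
    Measurable fun ω => before (exitRound A K ω) k - before (exitRound A' K' ω) k :=
  (measurable_before_comp (measurable_exitRound hA K) k).sub
    (measurable_before_comp (measurable_exitRound hA' K') k)

lemma integrable_norm_sub_exitRound_sq {A A' : Set (Space n)} (hA : MeasurableSet A)
    (hA' : MeasurableSet A') (K K' : ℕ) :
    Integrable (fun ω => ‖ω (exitRound A K ω) - ω (exitRound A' K' ω)‖ ^ 2)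
      (gameMeasure hp hε S P) := by
  simpa only [pathTransform_before_sub] using
    integrable_norm_pathTransform_sq (hp := hp) (hε := hε) (S := S) (P := P)
      (measurable_before_sub hA hA' K K') (fun k ω => abs_before_sub_before_le _ _ _) (max K K')

/-- The mean square distance of two stopped positions is controlled by the mean time between. -/
lemma integral_norm_sub_exitRound_sq_le {A A' : Set (Space n)} (hA : MeasurableSet A)
    (hA' : MeasurableSet A') (K K' : ℕ) :
    ∫ ω, ‖ω (exitRound A K ω) - ω (exitRound A' K' ω)‖ ^ 2 ∂(gameMeasure hp hε S P)
      ≤ ε ^ 2 * ∫ ω, |(exitRound A K ω : ℝ) - exitRound A' K' ω| ∂(gameMeasure hp hε S P) := by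
  have h := integral_norm_pathTransform_sq_le (hp := hp) (hε := hε) (S := S) (P := P)
    (measurable_before_sub hA hA' K K') (fun k ω => abs_before_sub_before_le _ _ _)
    (fun k ω ω' h => by
      simp only [before, lt_exitRound_congr (A := A) (K := K) h,
        lt_exitRound_congr (A := A') (K := K') h]) (max K K')
  have h1 : ∀ ω : ℕ → Space n, exitRound A K ω ≤ max K K' := fun ω =>
    exitRound_le.trans (le_max_left _ _)
  have h2 : ∀ ω : ℕ → Space n, exitRound A' K' ω ≤ max K K' := fun ω =>
    exitRound_le.trans (le_max_right _ _)
  simpa only [pathTransform_before_sub, sum_sq_before_sub_before (h1 _) (h2 _)] using h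

lemma integrable_natCast_exitRound {A : Set (Space n)} (hA : MeasurableSet A) (K : ℕ) :
    Integrable (fun ω => (exitRound A K ω : ℝ)) (gameMeasure hp hε S P) := by
  refine Integrable.of_bound ((measurable_of_countable (fun m : ℕ => (m : ℝ))).comp
    (measurable_exitRound hA K)).aestronglyMeasurable (K : ℝ) (ae_of_all _ fun ω => ?_)
  rw [Real.norm_natCast]
  exact_mod_cast exitRound_le

/-- Once one of two parallel paths has left `Ω`, the other one leaves soon in mean. -/
lemma integral_exitRound_sub_min_le {Ω : Set (Space n)} {G : Space n → ℝ} {l c L ε₁ : ℝ}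
    (hG : IsBarrier p Ω G l c L ε₁) (hL : 0 ≤ L) (hΩo : IsOpen Ω) (hne : Ω.Nonempty)
    (hε1 : ε < ε₁) {a b : Space n} (ha : P.1 + a ∈ closure Ω) (hb : P.1 + b ∈ closure Ω) (K : ℕ) :
    c * ε ^ 2 * ∫ ω, ((exitRound {x | x + b ∈ Ω} K ω : ℝ)
        - (min (exitRound {x | x + a ∈ Ω} K ω) (exitRound {x | x + b ∈ Ω} K ω) : ℕ))
        ∂(gameMeasure hp hε S P) ≤ L * (2 * ε + ‖a - b‖) := by
  set A : Set (Space n) := {x | x + a ∈ Ω} with hA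
  set B : Set (Space n) := {x | x + b ∈ Ω} with hB
  have hAm : MeasurableSet A := (hΩo.preimage (by fun_prop)).measurableSet
  have hBm : MeasurableSet B := (hΩo.preimage (by fun_prop)).measurableSet
  -- Indicator of the rounds in which the path shifted by `a` has stopped and the one shifted by `b`
  -- is still running.
  set Y : ℕ → (ℕ → Space n) → ℝ := fun k ω =>
    before (exitRound B K ω) k - before (min (exitRound A K ω) (exitRound B K ω)) k with hY
  have hYm : ∀ k, Measurable (Y k) := fun k =>
    (measurable_before_comp (measurable_exitRound hBm K) k).sub
      (measurable_before_comp ((measurable_exitRound hAm K).min (measurable_exitRound hBm K)) k)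
  have hY1 : ∀ k ω, |Y k ω| ≤ 1 := fun k ω => abs_before_sub_before_le _ _ _
  have hYi : ∀ k, Integrable (Y k) (gameMeasure hp hε S P) := fun k =>
    Integrable.of_bound (hYm k).aestronglyMeasurable 1 (ae_of_all _ (hY1 k))
  have hYcases : ∀ k ω, Y k ω = 0 ∨ (Y k ω = 1 ∧ ω k + b ∈ Ω) := by
    intro k ω
    by_cases h1 : k < exitRound B K ω
    · have h2 : ω k + b ∈ Ω := (lt_exitRound_iff.1 h1 k le_rfl).1
      by_cases h3 : k < exitRound A K ω
      · left; simp [hY, before, h1, h3]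
      · right; exact ⟨by simp [hY, before, h1, h3], h2⟩
    · left; simp [hY, before, h1]
  have hGc := hG.continuous
  have hinc : ∀ k, Integrable (fun ω => Y k ω * (G (ω (k + 1) + b) - G (ω k + b)))
      (gameMeasure hp hε S P) := fun k => by
    refine Integrable.of_bound ((hYm k).mul (by fun_prop)).aestronglyMeasurable 2
      (ae_of_all _ fun ω => ?_)
    rw [norm_mul, Real.norm_eq_abs, Real.norm_eq_abs]
    have h1 := abs_sub (G (ω (k + 1) + b)) (G (ω k + b))
    have h2 := hG.abs_le_one (ω (k + 1) + b)
    have h3 := hG.abs_le_one (ω k + b)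
    calc |Y k ω| * |G (ω (k + 1) + b) - G (ω k + b)| ≤ 1 * 2 :=
          mul_le_mul (hY1 k ω) (by linarith) (abs_nonneg _) zero_le_one
      _ = 2 := one_mul 2
  have hstep : ∀ k, c * ε ^ 2 * ∫ ω, Y k ω ∂(gameMeasure hp hε S P)
      ≤ ∫ ω, Y k ω * (G (ω (k + 1) + b) - G (ω k + b)) ∂(gameMeasure hp hε S P) := by
    intro k
    -- The signs are reversed because the drift is a lower bound, while `integral_step_le` gives
    -- upper bounds.
    have h := integral_step_le (hp := hp) (hε := hε) (S := S) (P := P) (k := k)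
      (Φ := fun ω y => -(Y k ω * (G (y + b) - G (ω k + b))))
      (Ψ := fun ω => -(c * ε ^ 2 * Y k ω)) ?_ ?_ (hinc k).neg ((hYi k).const_mul _).neg ?_
    · rw [integral_neg, integral_neg, integral_const_mul] at h
      linarith
    · have h1 : Measurable fun q : (ℕ → Space n) × Space n => G (q.2 + b) - G (q.1 k + b) := by
        fun_prop
      exact (((hYm k).comp measurable_fst).mul h1).neg
    · intro ω ω' h
      ext1 y
      simp only [hY, before, lt_min_iff, lt_exitRound_congr (A := A) (K := K) h,
        lt_exitRound_congr (A := B) (K := K) h, h k le_rfl]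
    · intro ω
      have hσ : ‖S.dirAt P.2 k ω‖ = 1 := S.norm_dirAt P.2 k ω
      have := isProbabilityMeasure_stepMeasure hp hε (ω k) (S.dirAt P.2 k ω)
      rw [integral_neg, integral_const_mul, neg_le_neg_iff, integral_sub
        (integrable_stepMeasure_of_continuous hp hε hσ (by fun_prop)) (integrable_const _),
        integral_add_right_stepMeasure]
      rcases hYcases k ω with h0 | ⟨h1, h2⟩
      · simp [h0]
      · have := hG.drift ε hε hε1 _ h2 _ hσ
        rw [h1, one_mul, mul_one]
        simp only [integral_const, probReal_univ, one_smul]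
        linarith
  have hsumY : ∀ ω, ∑ k ∈ Finset.range K, Y k ω
      = (exitRound B K ω : ℝ) - (min (exitRound A K ω) (exitRound B K ω) : ℕ) := fun ω => by
    simp only [hY, Finset.sum_sub_distrib]
    rw [sum_before exitRound_le, sum_before (min_le_of_right_le exitRound_le)]
  have hsumG : ∀ ω : ℕ → Space n,
      ∑ k ∈ Finset.range K, Y k ω * (G (ω (k + 1) + b) - G (ω k + b))
      = G (ω (exitRound B K ω) + b)
        - G (ω (min (exitRound A K ω) (exitRound B K ω)) + b) := fun ω => by
    have h1 := sum_before_smul_sub (exitRound_le (A := B) (K := K) (ω := ω))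
      (fun k => G (ω k + b))
    have h2 := sum_before_smul_sub ((min_le_right (exitRound A K ω) (exitRound B K ω)).trans
      exitRound_le) (fun k => G (ω k + b))
    simp only [smul_eq_mul] at h1 h2
    simp only [hY, sub_mul, Finset.sum_sub_distrib, h1, h2]
    ring
  calc c * ε ^ 2 * ∫ ω, ((exitRound B K ω : ℝ)
        - (min (exitRound A K ω) (exitRound B K ω) : ℕ)) ∂(gameMeasure hp hε S P)
      = ∑ k ∈ Finset.range K, c * ε ^ 2 * ∫ ω, Y k ω ∂(gameMeasure hp hε S P) := by
        rw [← Finset.mul_sum, ← integral_finsetSum _ fun k _ => hYi k]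
        simp only [hsumY]
    _ ≤ ∑ k ∈ Finset.range K, ∫ ω, Y k ω * (G (ω (k + 1) + b) - G (ω k + b))
          ∂(gameMeasure hp hε S P) := Finset.sum_le_sum fun k _ => hstep k
    _ = ∫ ω, ∑ k ∈ Finset.range K, Y k ω * (G (ω (k + 1) + b) - G (ω k + b))
          ∂(gameMeasure hp hε S P) := (integral_finsetSum _ fun k _ => hinc k).symm
    _ ≤ ∫ _, L * (2 * ε + ‖a - b‖) ∂(gameMeasure hp hε S P) := by
        refine integral_mono_ae (integrable_finsetSum _ fun k _ => hinc k) (integrable_const _) ?_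
        filter_upwards [ae_norm_sub_le_gameMeasure hp hε S P, ae_zero_eq_gameMeasure hp hε S P]
          with ω hω h0
        simp only [hsumG]
        rcases le_or_gt (exitRound B K ω) (exitRound A K ω) with hle | hlt
        · rw [min_eq_right hle, sub_self]
          positivity
        · rw [min_eq_left hlt.le]
          have h1 : G (ω (exitRound B K ω) + b) ≤ l + L * ε :=
            hG.le_of_infDist_le hL hε.le hne
              (infDist_le_of_le_exitRound hε.le (h0 ▸ hb) hω le_rfl)
          -- Since this exit round is strictly below `K`, the path really left `Ω` and was not
          -- merely cut off by the horizon.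
          have h2 : l - L * ε ≤ G (ω (exitRound A K ω) + a) :=
            hG.le_of_notMem hL hne (notMem_of_exitRound_lt (hlt.trans_le exitRound_le))
              (infDist_le_of_le_exitRound hε.le (h0 ▸ ha) hω le_rfl)
          have h3 := (abs_le.1 (hG.lipschitz (ω (exitRound A K ω) + a)
            (ω (exitRound A K ω) + b))).2
          rw [add_sub_add_left_eq_sub] at h3
          linarith
    _ = _ := by simp

end Martingale

/-! ### Compactness of the strip and the modulus of the payoff -/

section BoundaryStrip

variable {n : ℕ} {Ω : Set (Space n)} {T ε : ℝ}

lemma closure_cylinder (hT : 0 < T) :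
    closure (cylinder Ω T) = closure Ω ×ˢ Set.Icc 0 T := by
  rw [cylinder, closure_prod_eq, closure_Ioo hT.ne]

lemma frontier_subset_outerStrip (hΩ : IsOpen Ω) (hε : 0 ≤ ε) : frontier Ω ⊆ outerStrip Ω ε := by
  intro x hx
  refine ⟨fun h => ?_, by rw [Metric.infDist_zero_of_mem hx]; exact hε⟩
  rw [hΩ.frontier_eq] at hx
  exact hx.2 h

lemma boundaryStrip_mono (hε : 0 < ε) (hε1 : ε < 1) :
    boundaryStrip Ω T ε ⊆ boundaryStrip Ω T 1 := by
  have h1 : -(1 : ℝ) ^ 2 ≤ -ε ^ 2 := by nlinarith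
  rintro Q (⟨h, h'⟩ | ⟨h, h'⟩)
  · exact Or.inl ⟨⟨h.1, h.2.trans hε1.le⟩, h1.trans h'.1, h'.2⟩
  · exact Or.inr ⟨h, h1.trans h'.1, h'.2⟩

lemma isClosed_outerStrip (hΩ : IsOpen Ω) : IsClosed (outerStrip Ω ε) :=
  hΩ.isClosed_compl.inter (isClosed_le (Metric.continuous_infDist_pt _) continuous_const)

lemma isCompact_boundaryStrip (hn : 1 ≤ n) (hΩ : IsGameDomain Ω) (hT : 0 < T) (hε : 0 ≤ ε) :
    IsCompact (boundaryStrip Ω T ε) := by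
  -- Closing `Ω` in the bottom part adds nothing: the new points lie over `frontier Ω` and belong to
  -- the lateral part.
  have heq : boundaryStrip Ω T ε
      = outerStrip Ω ε ×ˢ Set.Icc (-ε ^ 2) T ∪ closure Ω ×ˢ Set.Icc (-ε ^ 2) 0 := by
    refine Set.Subset.antisymm (Set.union_subset_union_right _
      (Set.prod_mono subset_closure subset_rfl)) ?_
    rintro Q (h | ⟨h, h'⟩)
    · exact Or.inl h
    · by_cases hQ : Q.1 ∈ Ω
      · exact Or.inr ⟨hQ, h'⟩
      · refine Or.inl ⟨frontier_subset_outerStrip hΩ.isOpen hε ?_, h'.1, h'.2.trans hT.le⟩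
        rw [hΩ.isOpen.frontier_eq]
        exact ⟨h, hQ⟩
  have hfr := hΩ.frontier_nonempty hn
  have hfb : Bornology.IsBounded (frontier Ω) :=
    hΩ.isBounded.closure.subset frontier_subset_closure
  have hb : Bornology.IsBounded (outerStrip Ω ε) := by
    refine (hfb.thickening (δ := ε + 1)).subset fun x hx => ?_
    exact Metric.mem_thickening_iff.2
      ((Metric.infDist_lt_iff hfr).1 (lt_of_le_of_lt hx.2 (lt_add_one ε)))
  rw [heq]
  exact ((Metric.isCompact_of_isClosed_isBounded (isClosed_outerStrip hΩ.isOpen) hb).prod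
    isCompact_Icc).union (hΩ.isBounded.isCompact_closure.prod isCompact_Icc)

lemma IsGameDomain.boundaryStrip_nonempty (hΩ : IsGameDomain Ω) :
    (boundaryStrip Ω T ε).Nonempty := by
  obtain ⟨x, hx⟩ := hΩ.isConnected.nonempty
  exact ⟨(x, 0), Or.inr ⟨hx, by simp only [neg_nonpos]; positivity, le_rfl⟩⟩

/-- A continuous function on a compact set has a modulus of continuity that is, up to a given
error, quadratic in space and linear in time. -/
lemma exists_parabolic_modulus {F : Space n × ℝ → ℝ} {A : Set (Space n × ℝ)} (hA : IsCompact A)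
    (hF : ContinuousOn F A) {η : ℝ} (hη : 0 < η) :
    ∃ C, 0 ≤ C ∧ ∀ X ∈ A, ∀ Y ∈ A, |F X - F Y| ≤ η + C * (‖X.1 - Y.1‖ ^ 2 + |X.2 - Y.2|) := by
  obtain ⟨M, hM⟩ := hA.exists_bound_of_continuousOn hF
  obtain ⟨d, hd, hdF⟩ := Metric.uniformContinuousOn_iff.1
    (hA.uniformContinuousOn_of_continuous hF) η hη
  -- Points at sup-distance at least `d` have parabolic distance at least `m`, so the oscillation `2
  -- * |M|` is absorbed by the factor `2 * |M| / m`.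
  set m := min (d ^ 2) d with hm
  have hm0 : 0 < m := by positivity
  refine ⟨2 * |M| / m, by positivity, fun X hX Y hY => ?_⟩
  set q := ‖X.1 - Y.1‖ ^ 2 + |X.2 - Y.2| with hq
  have hq0 : 0 ≤ q := by positivity
  rcases lt_or_ge (dist X Y) d with h | h
  · have h1 := (hdF X hX Y hY h).le
    rw [Real.dist_eq] at h1
    have : 0 ≤ 2 * |M| / m * q := by positivity
    linarith
  · have hmq : m ≤ q := by
      rw [Prod.dist_eq, le_max_iff, dist_eq_norm, Real.dist_eq] at h
      rcases h with h | h
      · calc m ≤ d ^ 2 := min_le_left _ _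
          _ ≤ ‖X.1 - Y.1‖ ^ 2 := by gcongr
          _ ≤ q := le_add_of_nonneg_right (abs_nonneg _)
      · calc m ≤ d := min_le_right _ _
          _ ≤ |X.2 - Y.2| := h
          _ ≤ q := le_add_of_nonneg_left (by positivity)
    have h1 := hM X hX
    have h2 := hM Y hY
    rw [Real.norm_eq_abs] at h1 h2
    calc |F X - F Y| ≤ |F X| + |F Y| := abs_sub _ _
      _ ≤ 2 * |M| := by linarith [le_abs_self M]
      _ = 2 * |M| / m * m := by field_simp
      _ ≤ 2 * |M| / m * q := by gcongr
      _ ≤ _ := by linarith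

end BoundaryStrip

/-! ### Comparison of the payoffs of coupled games -/

section Payoff

variable {n : ℕ} {p ε T : ℝ} {hp : 2 < p} {hε : 0 < ε} {S : Strategy n} {P : Space n × ℝ}
  {Ω : Set (Space n)} {F : Space n × ℝ → ℝ}

/-- The exit round of the path translated by `a`, for a game started at time `t`. -/
noncomputable def exitTime (Ω : Set (Space n)) (ε : ℝ) (a : Space n) (t : ℝ) (ω : ℕ → Space n) :
    ℕ := exitRound {x | x + a ∈ Ω} ⌈t / ε ^ 2⌉₊ ω

/-- The stopped token of the path translated by `a`, for a game started at time `t`. -/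
noncomputable def exitToken (Ω : Set (Space n)) (ε : ℝ) (a : Space n) (t : ℝ)
    (ω : ℕ → Space n) : Space n × ℝ :=
  (ω (exitTime Ω ε a t ω) + a, t - exitTime Ω ε a t ω * ε ^ 2)

/-- The horizon `⌈t / ε ^ 2⌉₊` is the first round with nonpositive time. One round before stopping,
the time was positive and the position in `Ω`, so neither overshoots the strip. -/
lemma exitToken_mem_boundaryStrip (hε : 0 < ε) (hne : Ω.Nonempty) {a : Space n} {t : ℝ}
    (ht : t ∈ Set.Icc 0 T) {ω : ℕ → Space n} (h0 : ω 0 + a ∈ closure Ω)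
    (hω : ∀ k, ‖ω (k + 1) - ω k‖ ≤ ε) :
    exitToken Ω ε a t ω ∈ boundaryStrip Ω T ε := by
  have hε2 : 0 < ε ^ 2 := by positivity
  set m := exitTime Ω ε a t ω with hm
  have hlo : -ε ^ 2 ≤ t - m * ε ^ 2 := by
    rcases hm' : m with _ | j
    · simp only [Nat.cast_zero, zero_mul, sub_zero]
      exact (neg_nonpos.2 hε2.le).trans ht.1
    · have hj : j < exitRound {x | x + a ∈ Ω} ⌈t / ε ^ 2⌉₊ ω := by
        change j < m; omega
      have h1 := Nat.lt_ceil.1 (lt_exitRound_iff.1 hj j le_rfl).2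
      rw [lt_div_iff₀ hε2] at h1
      push_cast
      linarith
  have hhi : t - m * ε ^ 2 ≤ T := by
    have : 0 ≤ (m : ℝ) * ε ^ 2 := by positivity
    linarith [ht.2]
  by_cases hmem : ω m + a ∈ Ω
  · refine Or.inr ⟨hmem, hlo, ?_⟩
    have h1 : ⌈t / ε ^ 2⌉₊ ≤ m :=
      (notMem_or_le_exitRound (A := {x | x + a ∈ Ω}) (ω := ω)).resolve_left (not_not.2 hmem)
    have h2 := Nat.ceil_le.1 h1
    rw [div_le_iff₀ hε2] at h2
    change t - m * ε ^ 2 ≤ 0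
    linarith
  · obtain ⟨y, hy, hxy⟩ := exists_frontier_dist_le hne hmem
      (infDist_le_of_le_exitRound hε.le h0 hω (le_refl m))
    exact Or.inl ⟨⟨hmem, (Metric.infDist_le_dist_of_mem hy).trans hxy⟩, hlo, hhi⟩

lemma token_stoppingRound (hε : 0 < ε) (hne : Ω.Nonempty) {a : Space n} {t : ℝ}
    (ht : t ∈ Set.Icc 0 T) {ω : ℕ → Space n} (h0 : ω 0 + a ∈ closure Ω)
    (hω : ∀ k, ‖ω (k + 1) - ω k‖ ≤ ε) :
    token ε t (fun k => ω k + a) (stoppingRound Ω T ε t (fun k => ω k + a))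
      = exitToken Ω ε a t ω := by
  have hmem := exitToken_mem_boundaryStrip hε hne ht h0 hω
  have heq : stoppingRound Ω T ε t (fun k => ω k + a) = exitTime Ω ε a t ω := by
    refine le_antisymm (Nat.sInf_le hmem) (le_csInf ⟨_, hmem⟩ fun k hk => Nat.sInf_le ?_)
    rcases hk with ⟨h, -⟩ | ⟨-, h⟩
    · exact Or.inl h.1
    · refine Or.inr (Nat.ceil_le.2 ?_)
      rw [div_le_iff₀ (by positivity)]
      have : t - k * ε ^ 2 ≤ 0 := h.2
      linarith
  rw [heq]
  rfl

lemma ae_exitToken_mem (hne : Ω.Nonempty) {a : Space n} {t : ℝ}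
    (ht : t ∈ Set.Icc 0 T) (ha : P.1 + a ∈ closure Ω) :
    ∀ᵐ ω ∂(gameMeasure hp hε S P), exitToken Ω ε a t ω ∈ boundaryStrip Ω T ε := by
  filter_upwards [ae_norm_sub_le_gameMeasure hp hε S P, ae_zero_eq_gameMeasure hp hε S P]
    with ω hω h0
  exact exitToken_mem_boundaryStrip hε hne ht (h0 ▸ ha) hω

lemma expectedPayoff_eq (hne : Ω.Nonempty) (ht : P.2 ∈ Set.Icc 0 T)
    (hx : P.1 ∈ closure Ω) :
    expectedPayoff hp hε Ω T F S P
      = ∫ ω, F (exitToken Ω ε 0 P.2 ω) ∂(gameMeasure hp hε S P) := by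
  refine integral_congr_ae ?_
  filter_upwards [ae_norm_sub_le_gameMeasure hp hε S P, ae_zero_eq_gameMeasure hp hε S P]
    with ω hω h0
  rw [← token_stoppingRound hε hne ht (by rw [h0, add_zero]; exact hx) hω]
  simp only [add_zero]

/-- The coupling: the payoff of the translated game as an integral over the path law of the original
one. -/
lemma expectedPayoff_translate (hne : Ω.Nonempty) {ξ : Space n} {s : ℝ}
    (ht : P.2 + s ∈ Set.Icc 0 T) (hx : P.1 + ξ ∈ closure Ω) :
    expectedPayoff hp hε Ω T F (S.translate ξ s) (P.1 + ξ, P.2 + s)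
      = ∫ ω, F (exitToken Ω ε ξ (P.2 + s) ω) ∂(gameMeasure hp hε S P) := by
  -- For an embedding the change of variables needs no measurability of the integrand; `F` is
  -- arbitrary off the strip.
  have hemb : MeasurableEmbedding fun (ω : ℕ → Space n) k => ω k + ξ :=
    (MeasurableEquiv.addRight (fun _ : ℕ => ξ)).measurableEmbedding
  rw [expectedPayoff, gameMeasure_translate, hemb.integral_map]
  refine integral_congr_ae ?_
  filter_upwards [ae_norm_sub_le_gameMeasure hp hε S P, ae_zero_eq_gameMeasure hp hε S P]
    with ω hω h0
  rw [← token_stoppingRound hε hne ht (h0 ▸ hx) hω]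

lemma measurable_exitTime (hΩ : IsOpen Ω) (a : Space n) (t : ℝ) :
    Measurable (exitTime Ω ε a t) :=
  measurable_exitRound (hΩ.preimage (by fun_prop)).measurableSet _

lemma measurable_exitToken (hΩ : IsOpen Ω) (a : Space n) (t : ℝ) :
    Measurable (exitToken Ω ε a t) := by
  have h := measurable_exitTime (ε := ε) hΩ a t
  have heval : Measurable fun q : ℕ × (ℕ → Space n) => q.2 q.1 :=
    measurable_from_prod_countable_right fun k => measurable_pi_apply k
  have hcast : Measurable fun ω => (exitTime Ω ε a t ω : ℝ) :=
    (measurable_of_countable (fun m : ℕ => (m : ℝ))).comp h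
  exact ((heval.comp (h.prodMk measurable_id)).add_const a).prodMk
    ((hcast.mul_const _).const_sub _)

lemma integrable_comp_exitToken (hΩ : IsOpen Ω) (hne : Ω.Nonempty)
    (hΓ : IsCompact (boundaryStrip Ω T 1)) (hF : ContinuousOn F (boundaryStrip Ω T 1))
    (hε1 : ε < 1) {a : Space n} {t : ℝ} (ht : t ∈ Set.Icc 0 T) (ha : P.1 + a ∈ closure Ω) :
    Integrable (fun ω => F (exitToken Ω ε a t ω)) (gameMeasure hp hε S P) := by
  classical
  obtain ⟨M, hM⟩ := hΓ.exists_bound_of_continuousOn hF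
  have hpw : Measurable ((boundaryStrip Ω T 1).piecewise F fun _ => 0) :=
    hF.measurable_piecewise continuousOn_const hΓ.measurableSet
  have hmem := ae_exitToken_mem (hp := hp) (hε := hε) (S := S) hne ht ha
  have hae : (fun ω => (boundaryStrip Ω T 1).piecewise F (fun _ => 0) (exitToken Ω ε a t ω))
      =ᵐ[gameMeasure hp hε S P] fun ω => F (exitToken Ω ε a t ω) := by
    filter_upwards [hmem] with ω hω
    exact Set.piecewise_eq_of_mem _ _ _ (boundaryStrip_mono hε hε1 hω)
  refine Integrable.of_bound
    ((hpw.comp (measurable_exitToken hΩ a t)).aestronglyMeasurable.congr hae) M ?_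
  filter_upwards [hmem] with ω hω
  exact hM _ (boundaryStrip_mono hε hε1 hω)

lemma abs_expectedPayoff_le (hne : Ω.Nonempty) {M : ℝ}
    (hM : ∀ Q ∈ boundaryStrip Ω T 1, |F Q| ≤ M) (hε1 : ε < 1)
    (ht : P.2 ∈ Set.Icc 0 T) (hx : P.1 ∈ closure Ω) :
    |expectedPayoff hp hε Ω T F S P| ≤ M := by
  rw [expectedPayoff_eq hne ht hx]
  have h : ∀ᵐ ω ∂(gameMeasure hp hε S P), ‖F (exitToken Ω ε 0 P.2 ω)‖ ≤ M := by
    filter_upwards [ae_exitToken_mem (hp := hp) (hε := hε) (S := S) hne ht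
      (a := 0) (by rwa [add_zero])] with ω hω
    exact hM _ (boundaryStrip_mono hε hε1 hω)
  simpa using norm_integral_le_of_norm_le_const h

/-- The mean difference of the durations of two games played in parallel. -/
lemma integral_abs_exitTime_sub_le {G : Space n → ℝ} {l c L ε₁ : ℝ}
    (hG : IsBarrier p Ω G l c L ε₁) (hc : 0 < c) (hL : 0 ≤ L) (hΩ : IsOpen Ω)
    (hne : Ω.Nonempty) (hε1 : ε < ε₁) {a b : Space n} {t u : ℝ} (ha : P.1 + a ∈ closure Ω)
    (hb : P.1 + b ∈ closure Ω) (ht : 0 ≤ t) (hu : 0 ≤ u) :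
    ε ^ 2 * ∫ ω, |(exitTime Ω ε a t ω : ℝ) - exitTime Ω ε b u ω| ∂(gameMeasure hp hε S P)
      ≤ 2 * L / c * (2 * ε + ‖a - b‖) + |t - u| + ε ^ 2 := by
  have hε2 : 0 < ε ^ 2 := by positivity
  set μ := gameMeasure hp hε S P with hμ
  set K := ⌈t / ε ^ 2⌉₊ with hK
  set K' := ⌈u / ε ^ 2⌉₊ with hK'
  set A : Set (Space n) := {x | x + a ∈ Ω} with hA
  set B : Set (Space n) := {x | x + b ∈ Ω} with hB
  have hAm : MeasurableSet A := (hΩ.preimage (by fun_prop)).measurableSet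
  have hBm : MeasurableSet B := (hΩ.preimage (by fun_prop)).measurableSet
  have hKK : |(K : ℝ) - K'| ≤ |t - u| / ε ^ 2 + 1 := by
    have h1 := Nat.le_ceil (t / ε ^ 2)
    have h2 := Nat.ceil_lt_add_one (div_nonneg ht hε2.le)
    have h3 := Nat.le_ceil (u / ε ^ 2)
    have h4 := Nat.ceil_lt_add_one (div_nonneg hu hε2.le)
    rw [← hK] at h1 h2
    rw [← hK'] at h3 h4
    have h5 : |t - u| / ε ^ 2 = |t / ε ^ 2 - u / ε ^ 2| := by
      rw [← sub_div, abs_div, abs_of_pos hε2]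
    have h6 := abs_le.1 (le_refl |t / ε ^ 2 - u / ε ^ 2|)
    rw [h5, abs_le]
    constructor <;> linarith [h6.1, h6.2]
  -- Both exits are compared under the common horizon `K`, where the barrier applies in each order;
  -- then the horizon of `B` is changed to `K'`.
  have hpt : ∀ ω : ℕ → Space n, |(exitRound A K ω : ℝ) - exitRound B K' ω|
      ≤ ((exitRound B K ω : ℝ) - (min (exitRound A K ω) (exitRound B K ω) : ℕ))
        + ((exitRound A K ω : ℝ) - (min (exitRound B K ω) (exitRound A K ω) : ℕ))
        + |(K : ℝ) - K'| := by
    intro ω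
    have h1 : |(exitRound B K ω : ℝ) - exitRound B K' ω| ≤ |(K : ℝ) - K'| := by
      have h2 := exitRound_le_add B K K' ω
      have h3 := exitRound_le_add B K' K ω
      have h4 : |(exitRound B K ω : ℤ) - exitRound B K' ω| ≤ |(K : ℤ) - K'| := by
        rcases abs_cases ((K : ℤ) - K') with h | h <;> rw [abs_le] <;> omega
      exact_mod_cast h4
    have h5 := abs_sub_le (exitRound A K ω : ℝ) (exitRound B K ω) (exitRound B K' ω)
    have h6 : |(exitRound A K ω : ℝ) - exitRound B K ω|
        = ((exitRound B K ω : ℝ) - (min (exitRound A K ω) (exitRound B K ω) : ℕ))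
        + ((exitRound A K ω : ℝ) - (min (exitRound B K ω) (exitRound A K ω) : ℕ)) := by
      rw [min_comm (exitRound B K ω)]
      rcases le_total (exitRound A K ω) (exitRound B K ω) with h | h
      · have h' : (exitRound A K ω : ℝ) ≤ exitRound B K ω := by exact_mod_cast h
        rw [min_eq_left h, abs_of_nonpos (by linarith)]; ring
      · have h' : (exitRound B K ω : ℝ) ≤ exitRound A K ω := by exact_mod_cast h
        rw [min_eq_right h, abs_of_nonneg (by linarith)]; ring
    linarith
  have hiA : ∀ K, Integrable (fun ω => (exitRound A K ω : ℝ)) μ :=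
    fun K => integrable_natCast_exitRound hAm K
  have hiB : ∀ K, Integrable (fun ω => (exitRound B K ω : ℝ)) μ :=
    fun K => integrable_natCast_exitRound hBm K
  have hi1 : Integrable (fun ω => (exitRound B K ω : ℝ)
      - (min (exitRound A K ω) (exitRound B K ω) : ℕ)) μ := by
    simp only [Nat.cast_min]
    exact (hiB K).sub ((hiA K).inf (hiB K))
  have hi2 : Integrable (fun ω => (exitRound A K ω : ℝ)
      - (min (exitRound B K ω) (exitRound A K ω) : ℕ)) μ := by
    simp only [Nat.cast_min]
    exact (hiA K).sub ((hiB K).inf (hiA K))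
  have hg1 := integral_exitRound_sub_min_le (hp := hp) (hε := hε) (S := S) (P := P) hG hL hΩ hne
    hε1 ha hb K
  have hg2 := integral_exitRound_sub_min_le (hp := hp) (hε := hε) (S := S) (P := P) hG hL hΩ hne
    hε1 hb ha K
  rw [norm_sub_rev b a] at hg2
  rw [← hA, ← hB, ← hμ] at hg1 hg2
  set I₁ := ∫ ω, ((exitRound B K ω : ℝ) - (min (exitRound A K ω) (exitRound B K ω) : ℕ)) ∂μ
    with hI₁
  set I₂ := ∫ ω, ((exitRound A K ω : ℝ) - (min (exitRound B K ω) (exitRound A K ω) : ℕ)) ∂μ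
    with hI₂
  have hint : ∫ ω, |(exitRound A K ω : ℝ) - exitRound B K' ω| ∂μ ≤ I₁ + I₂ + |(K : ℝ) - K'| := by
    refine (integral_mono ((hiA K).sub (hiB K')).abs
      ((hi1.add hi2).add (integrable_const |(K : ℝ) - K'|)) hpt).trans (le_of_eq ?_)
    rw [integral_add' (hi1.add hi2) (integrable_const _), integral_add' hi1 hi2, hI₁, hI₂]
    simp
  have hg1' : ε ^ 2 * I₁ ≤ L / c * (2 * ε + ‖a - b‖) := by
    rw [div_mul_eq_mul_div, le_div_iff₀ hc]; linarith
  have hg2' : ε ^ 2 * I₂ ≤ L / c * (2 * ε + ‖a - b‖) := by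
    rw [div_mul_eq_mul_div, le_div_iff₀ hc]; linarith
  have hKε : ε ^ 2 * |(K : ℝ) - K'| ≤ |t - u| + ε ^ 2 := by
    calc ε ^ 2 * |(K : ℝ) - K'| ≤ ε ^ 2 * (|t - u| / ε ^ 2 + 1) := by gcongr
      _ = _ := by field_simp
  calc ε ^ 2 * ∫ ω, |(exitRound A K ω : ℝ) - exitRound B K' ω| ∂μ
      ≤ ε ^ 2 * (I₁ + I₂ + |(K : ℝ) - K'|) := by gcongr
    _ = ε ^ 2 * I₁ + ε ^ 2 * I₂ + ε ^ 2 * |(K : ℝ) - K'| := by ring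
    _ ≤ L / c * (2 * ε + ‖a - b‖) + L / c * (2 * ε + ‖a - b‖) + (|t - u| + ε ^ 2) := by gcongr
    _ = _ := by ring

lemma parabolic_dist_exitToken_le (ξ : Space n) (t s : ℝ) (ω : ℕ → Space n) :
    ‖(exitToken Ω ε 0 t ω).1 - (exitToken Ω ε ξ (t + s) ω).1‖ ^ 2
        + |(exitToken Ω ε 0 t ω).2 - (exitToken Ω ε ξ (t + s) ω).2|
      ≤ 2 * ‖ω (exitTime Ω ε 0 t ω) - ω (exitTime Ω ε ξ (t + s) ω)‖ ^ 2
        + ε ^ 2 * |(exitTime Ω ε 0 t ω : ℝ) - exitTime Ω ε ξ (t + s) ω|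
        + (2 * ‖ξ‖ ^ 2 + |s|) := by
  simp only [exitToken, add_zero]
  generalize exitTime Ω ε 0 t ω = i
  generalize exitTime Ω ε ξ (t + s) ω = j
  have e1 : ‖ω i - (ω j + ξ)‖ ^ 2 ≤ 2 * ‖ω i - ω j‖ ^ 2 + 2 * ‖ξ‖ ^ 2 := by
    rw [← sub_sub]
    have h3 := norm_sub_le (ω i - ω j) ξ
    calc ‖ω i - ω j - ξ‖ ^ 2 ≤ (‖ω i - ω j‖ + ‖ξ‖) ^ 2 := by gcongr
      _ ≤ _ := by nlinarith [sq_nonneg (‖ω i - ω j‖ - ‖ξ‖)]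
  have e2 : |t - i * ε ^ 2 - (t + s - j * ε ^ 2)| ≤ ε ^ 2 * |(i : ℝ) - j| + |s| := by
    rw [show t - i * ε ^ 2 - (t + s - j * ε ^ 2) = -(ε ^ 2 * ((i : ℝ) - j)) - s by ring]
    refine (abs_sub _ _).trans ?_
    rw [abs_neg, abs_mul, abs_of_nonneg (sq_nonneg ε)]
  linarith

lemma abs_integral_le_of_abs_le_affine {α : Type*} [MeasurableSpace α] {μ : Measure α}
    [IsProbabilityMeasure μ] {f X Y : α → ℝ} (hX : Integrable X μ) (hY : Integrable Y μ)
    {η C d e k : ℝ} (h : ∀ᵐ ω ∂μ, |f ω| ≤ η + C * (d * X ω + e * Y ω + k)) :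
    |∫ ω, f ω ∂μ| ≤ η + C * (d * ∫ ω, X ω ∂μ + e * ∫ ω, Y ω ∂μ + k) := by
  have h1 : Integrable (fun ω => d * X ω + e * Y ω) μ := (hX.const_mul d).add (hY.const_mul e)
  have h2 : Integrable (fun ω => C * (d * X ω + e * Y ω + k)) μ :=
    (h1.add (integrable_const k)).const_mul C
  have h3 : Integrable (fun ω => η + C * (d * X ω + e * Y ω + k)) μ :=
    (integrable_const η).add h2
  rw [← Real.norm_eq_abs]
  simp only [← Real.norm_eq_abs] at h
  refine (norm_integral_le_of_norm_le h3 h).trans (le_of_eq ?_)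
  rw [integral_add (integrable_const η) h2, integral_const_mul,
    integral_add h1 (integrable_const k), integral_add (hX.const_mul d) (hY.const_mul e),
    integral_const_mul, integral_const_mul]
  simp

/-- Translating the starting point and the strategy changes the expected payoff by little. -/
lemma abs_expectedPayoff_sub_translate_le {G : Space n → ℝ} {l c L ε₁ : ℝ}
    (hG : IsBarrier p Ω G l c L ε₁) (hc : 0 < c) (hL : 0 ≤ L) (hΩ : IsOpen Ω)
    (hne : Ω.Nonempty) (hΓ : IsCompact (boundaryStrip Ω T 1))
    (hF : ContinuousOn F (boundaryStrip Ω T 1)) {η C : ℝ} (hC : 0 ≤ C)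
    (hmod : ∀ X ∈ boundaryStrip Ω T 1, ∀ Y ∈ boundaryStrip Ω T 1,
      |F X - F Y| ≤ η + C * (‖X.1 - Y.1‖ ^ 2 + |X.2 - Y.2|))
    (hε1 : ε < 1) (hεb : ε < ε₁) {ξ : Space n} {s : ℝ} (hP1 : P.1 ∈ closure Ω)
    (hP2 : P.2 ∈ Set.Icc 0 T) (hQ1 : P.1 + ξ ∈ closure Ω) (hQ2 : P.2 + s ∈ Set.Icc 0 T) :
    |expectedPayoff hp hε Ω T F S P
        - expectedPayoff hp hε Ω T F (S.translate ξ s) (P.1 + ξ, P.2 + s)|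
      ≤ η + C * (3 * (2 * L / c * (2 * ε + ‖ξ‖) + |s| + ε ^ 2) + 2 * ‖ξ‖ ^ 2 + |s|) := by
  have hP1' : P.1 + 0 ∈ closure Ω := by rwa [add_zero]
  have hAm : MeasurableSet {x | x + (0 : Space n) ∈ Ω} :=
    (hΩ.preimage (by fun_prop)).measurableSet
  have hBm : MeasurableSet {x | x + ξ ∈ Ω} := (hΩ.preimage (by fun_prop)).measurableSet
  rw [expectedPayoff_eq hne hP2 hP1, expectedPayoff_translate hne hQ2 hQ1]
  have hi1 := integrable_comp_exitToken (hp := hp) (hε := hε) (S := S) hΩ hne hΓ hF hε1 hP2 hP1'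
  have hi2 := integrable_comp_exitToken (hp := hp) (hε := hε) (S := S) hΩ hne hΓ hF hε1 hQ2 hQ1
  rw [← integral_sub hi1 hi2]
  set μ := gameMeasure hp hε S P with hμ
  set τ := exitTime Ω ε (0 : Space n) P.2 with hτ
  set τ' := exitTime Ω ε ξ (P.2 + s) with hτ'
  have hiτ : Integrable (fun ω => |(τ ω : ℝ) - τ' ω|) μ :=
    ((integrable_natCast_exitRound hAm _).sub (integrable_natCast_exitRound hBm _)).abs
  have hix : Integrable (fun ω => ‖ω (τ ω) - ω (τ' ω)‖ ^ 2) μ :=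
    integrable_norm_sub_exitRound_sq hAm hBm _ _
  have hpt : ∀ᵐ ω ∂μ, |F (exitToken Ω ε 0 P.2 ω) - F (exitToken Ω ε ξ (P.2 + s) ω)|
      ≤ η + C * (2 * ‖ω (τ ω) - ω (τ' ω)‖ ^ 2 + ε ^ 2 * |(τ ω : ℝ) - τ' ω|
        + (2 * ‖ξ‖ ^ 2 + |s|)) := by
    filter_upwards [ae_exitToken_mem (hp := hp) (hε := hε) (S := S) hne hP2 hP1',
      ae_exitToken_mem (hp := hp) (hε := hε) (S := S) hne hQ2 hQ1] with ω h1 h2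
    refine (hmod _ (boundaryStrip_mono hε hε1 h1) _ (boundaryStrip_mono hε hε1 h2)).trans ?_
    exact add_le_add le_rfl
      (mul_le_mul_of_nonneg_left (parabolic_dist_exitToken_le ξ P.2 s ω) hC)
  have hT1 : ε ^ 2 * ∫ ω, |(τ ω : ℝ) - τ' ω| ∂μ
      ≤ 2 * L / c * (2 * ε + ‖ξ‖) + |s| + ε ^ 2 := by
    have h := integral_abs_exitTime_sub_le (hp := hp) (hε := hε) (S := S) hG hc hL hΩ hne hεb
      hP1' hQ1 hP2.1 hQ2.1
    rwa [zero_sub, norm_neg, sub_add_cancel_left, abs_neg] at h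
  have hT2 : ∫ ω, ‖ω (τ ω) - ω (τ' ω)‖ ^ 2 ∂μ ≤ ε ^ 2 * ∫ ω, |(τ ω : ℝ) - τ' ω| ∂μ :=
    integral_norm_sub_exitRound_sq_le hAm hBm _ _
  refine (abs_integral_le_of_abs_le_affine hix hiτ hpt).trans ?_
  -- The factor `3` counts the bound on the mean time gap twice for the squared distance and once
  -- for the time itself.
  have hsum := mul_le_mul_of_nonneg_left (show 2 * ∫ ω, ‖ω (τ ω) - ω (τ' ω)‖ ^ 2 ∂μ
    + ε ^ 2 * ∫ ω, |(τ ω : ℝ) - τ' ω| ∂μ + (2 * ‖ξ‖ ^ 2 + |s|)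
    ≤ 3 * (2 * L / c * (2 * ε + ‖ξ‖) + |s| + ε ^ 2) + 2 * ‖ξ‖ ^ 2 + |s| by linarith) hC
  linarith

end Payoff

/-! ### From payoffs to values -/

section Value

variable {n : ℕ} {p ε T : ℝ} {hp : 2 < p} {hε : 0 < ε} {P Q : Space n × ℝ}
  {Ω : Set (Space n)} {F : Space n × ℝ → ℝ}

lemma nonempty_strategy (hn : 1 ≤ n) : Nonempty (Strategy n) :=
  ⟨⟨fun _ _ _ => EuclideanSpace.single ⟨0, hn⟩ 1, fun _ => measurable_const, fun _ _ _ => by simp⟩⟩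

/-- Needed because a real supremum over an unbounded family takes the default value `0`. -/
lemma bddAbove_expectedPayoff (hne : Ω.Nonempty) {M : ℝ}
    (hM : ∀ Q ∈ boundaryStrip Ω T 1, |F Q| ≤ M) (hε1 : ε < 1)
    (ht : P.2 ∈ Set.Icc 0 T) (hx : P.1 ∈ closure Ω) :
    BddAbove (Set.range fun S => expectedPayoff hp hε Ω T F S P) := by
  refine ⟨M, ?_⟩
  rintro _ ⟨S, rfl⟩
  exact (abs_le.1 (abs_expectedPayoff_le hne hM hε1 ht hx)).2

lemma abs_value_le (hn : 1 ≤ n) (hne : Ω.Nonempty) {M : ℝ}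
    (hM : ∀ Q ∈ boundaryStrip Ω T 1, |F Q| ≤ M) (hε1 : ε < 1)
    (ht : P.2 ∈ Set.Icc 0 T) (hx : P.1 ∈ closure Ω) : |value hp hε Ω T F P| ≤ M := by
  have hS := nonempty_strategy hn
  have h := fun S => abs_le.1 (abs_expectedPayoff_le (hp := hp) (hε := hε) (S := S)
    hne hM hε1 ht hx)
  obtain ⟨S⟩ := nonempty_strategy hn
  refine abs_le.2 ⟨(h S).1.trans (le_ciSup
    (f := fun S => expectedPayoff hp hε Ω T F S P)
    (bddAbove_expectedPayoff hne hM hε1 ht hx) S), ciSup_le fun S => (h S).2⟩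

lemma norm_fst_sub_le_spaceTimeDist (P Q : Space n × ℝ) : ‖P.1 - Q.1‖ ≤ spaceTimeDist P Q :=
  Real.le_sqrt_of_sq_le (le_add_of_nonneg_right (sq_nonneg _))

lemma abs_snd_sub_le_spaceTimeDist (P Q : Space n × ℝ) : |P.2 - Q.2| ≤ spaceTimeDist P Q := by
  refine Real.le_sqrt_of_sq_le ?_
  rw [sq_abs]
  exact le_add_of_nonneg_left (sq_nonneg _)

lemma spaceTimeDist_comm (P Q : Space n × ℝ) : spaceTimeDist P Q = spaceTimeDist Q P := by
  rw [spaceTimeDist, spaceTimeDist, norm_sub_rev, ← neg_sub Q.2 P.2, neg_sq]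

/-- One-sided equicontinuity of the value functions. -/
lemma exists_value_le_value_add (hn : 1 ≤ n) (hp : 2 < p) (hΩ : IsGameDomain Ω) (hT : 0 < T)
    (hF : ContinuousOn F (boundaryStrip Ω T 1)) {η : ℝ} (hη : 0 < η) :
    ∃ ρ : ℝ, 0 < ρ ∧ ∀ (ε : ℝ) (hε : 0 < ε), ε < 1 → ε < ρ →
      ∀ P ∈ closure (cylinder Ω T), ∀ Q ∈ closure (cylinder Ω T), spaceTimeDist P Q < ρ →
        value hp hε Ω T F P ≤ value hp hε Ω T F Q + η := by
  have hne := hΩ.isConnected.nonempty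
  have hS := nonempty_strategy hn
  have hΓ := isCompact_boundaryStrip hn hΩ hT zero_le_one
  obtain ⟨M, hM⟩ := hΓ.exists_bound_of_continuousOn hF
  obtain ⟨G, l, c, L, ε₁, hc, hL, hε₁, hG⟩ := exists_isBarrier hn hp hΩ
  obtain ⟨C, hC, hmod⟩ := exists_parabolic_modulus hΓ hF (half_pos hη)
  -- With `ε`, `‖ξ‖`, `|s|` at most `ρ ≤ 1`, the error is at most `C * (3 * (6 * (L / c) + 2) + 3) *
  -- ρ = C * B * ρ`. The `+ 1` in `C * B + 1` covers `C = 0`.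
  set B : ℝ := 18 * (L / c) + 9 with hB
  have hB0 : 0 < B := by positivity
  have hD : 0 < 2 * (C * B + 1) := by positivity
  refine ⟨min 1 (min ε₁ (η / (2 * (C * B + 1)))), by positivity, ?_⟩
  set ρ := min 1 (min ε₁ (η / (2 * (C * B + 1)))) with hρ
  have hρ0 : 0 < ρ := by positivity
  have hρ1 : ρ ≤ 1 := min_le_left _ _
  have hρε : ρ ≤ ε₁ := (min_le_right _ _).trans (min_le_left _ _)
  have hρη : ρ ≤ η / (2 * (C * B + 1)) := (min_le_right _ _).trans (min_le_right _ _)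
  intro ε hε hε1 hερ P hP Q hQ hPQ
  rw [closure_cylinder hT] at hP hQ
  obtain ⟨ξ, hξ⟩ : ∃ ξ, ξ = Q.1 - P.1 := ⟨_, rfl⟩
  obtain ⟨s, hs⟩ : ∃ s, s = Q.2 - P.2 := ⟨_, rfl⟩
  have hQ1 : P.1 + ξ = Q.1 := by rw [hξ]; abel
  have hQ2 : P.2 + s = Q.2 := by rw [hs]; ring
  have hξρ : ‖ξ‖ ≤ ρ := by
    rw [hξ, norm_sub_rev]; exact (norm_fst_sub_le_spaceTimeDist P Q).trans hPQ.le
  have hsρ : |s| ≤ ρ := by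
    rw [hs, abs_sub_comm]; exact (abs_snd_sub_le_spaceTimeDist P Q).trans hPQ.le
  refine ciSup_le fun S => ?_
  have hmain := abs_expectedPayoff_sub_translate_le (hp := hp) (hε := hε) (S := S) hG hc hL
    hΩ.isOpen hne hΓ hF hC hmod hε1 (hερ.trans_le hρε) hP.1 hP.2 (ξ := ξ) (s := s)
    (by rw [hQ1]; exact hQ.1) (by rw [hQ2]; exact hQ.2)
  rw [hQ1, hQ2, Prod.mk.eta] at hmain
  have hsup : expectedPayoff hp hε Ω T F (S.translate ξ s) Q ≤ value hp hε Ω T F Q :=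
    le_ciSup (f := fun S => expectedPayoff hp hε Ω T F S Q)
      (bddAbove_expectedPayoff hne hM hε1 hQ.2 hQ.1) _
  have herr : C * (3 * (2 * L / c * (2 * ε + ‖ξ‖) + |s| + ε ^ 2) + 2 * ‖ξ‖ ^ 2 + |s|)
      ≤ η / 2 := by
    have h1 : ε ^ 2 ≤ ρ := by nlinarith
    have h2 : ‖ξ‖ ^ 2 ≤ ρ := by nlinarith [norm_nonneg ξ]
    have h3 : 2 * L / c * (2 * ε + ‖ξ‖) ≤ 2 * L / c * (3 * ρ) := by gcongr; linarith
    have h4 : 2 * L / c * (3 * ρ) = 6 * (L / c) * ρ := by ring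
    calc C * (3 * (2 * L / c * (2 * ε + ‖ξ‖) + |s| + ε ^ 2) + 2 * ‖ξ‖ ^ 2 + |s|)
        ≤ C * (B * ρ) := mul_le_mul_of_nonneg_left (by rw [hB]; linarith) hC
      _ ≤ (C * B + 1) * ρ := by linarith
      _ ≤ (C * B + 1) * (η / (2 * (C * B + 1))) := by gcongr
      _ = η / 2 := by field_simp
  linarith [(abs_le.1 hmain).2]

end Value

end DominativeGame

theorem lemma4p2 {n : ℕ} (hn : 1 ≤ n) {p : ℝ} (hp : 2 < p)
    {Ω : Set (DominativeGame.Space n)} (hΩ : DominativeGame.IsGameDomain Ω)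
    {T : ℝ} (hT : 0 < T) (F : DominativeGame.Space n × ℝ → ℝ)
    (hF : ContinuousOn F (DominativeGame.boundaryStrip Ω T 1)) :
    (∃ M : ℝ, IsGreatest ((fun Q => |F Q|) '' DominativeGame.boundaryStrip Ω T 1) M ∧
      ∀ (ε : ℝ) (hε : 0 < ε), ε < 1 → ∀ P ∈ closure (DominativeGame.cylinder Ω T),
        |DominativeGame.value hp hε Ω T F P| ≤ M) ∧
    (∀ η : ℝ, 0 < η → ∃ r₀ : ℝ, 0 < r₀ ∧ ∃ ε₀ : ℝ, 0 < ε₀ ∧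
      ∀ (ε : ℝ) (hε : 0 < ε), ε < 1 → ε < ε₀ →
        ∀ P ∈ closure (DominativeGame.cylinder Ω T),
        ∀ Q ∈ closure (DominativeGame.cylinder Ω T),
          DominativeGame.spaceTimeDist P Q < r₀ →
          |DominativeGame.value hp hε Ω T F P - DominativeGame.value hp hε Ω T F Q| < η) := by
  have hne := hΩ.isConnected.nonempty
  have hΓ := DominativeGame.isCompact_boundaryStrip hn hΩ hT zero_le_one
  refine ⟨?_, fun η hη => ?_⟩
  · obtain ⟨M, hM⟩ := (hΓ.image_of_continuousOn hF.abs).exists_isGreatest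
      (hΩ.boundaryStrip_nonempty.image _)
    refine ⟨M, hM, fun ε hε hε1 P hP => ?_⟩
    rw [DominativeGame.closure_cylinder hT] at hP
    exact DominativeGame.abs_value_le hn hne
      (fun Q hQ => hM.2 (Set.mem_image_of_mem _ hQ)) hε1 hP.2 hP.1
  -- Half of `η` turns the weak one-sided bounds into a strict one.
  · obtain ⟨ρ, hρ, h⟩ := DominativeGame.exists_value_le_value_add hn hp hΩ hT hF (half_pos hη)
    refine ⟨ρ, hρ, ρ, hρ, fun ε hε hε1 hερ P hP Q hQ hPQ => ?_⟩
    have h1 := h ε hε hε1 hερ P hP Q hQ hPQ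
    have h2 := h ε hε hε1 hερ Q hQ P hP (by rwa [DominativeGame.spaceTimeDist_comm])
    rw [abs_lt]
    constructor <;> linarith
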